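/- \textbf{Setting.} A \emph{domain} is a tuple $D=(F,A,\mathcal C,\delta,M)$ of a finite set $F$ of propositions, a finite set $A$ of actions, a finite set $\mathcal C$ of compound task names disjoint from $A$, a map $\delta\colon a\mapsto(\mathrm{pre}(a),\mathrm{del}(a),\mathrm{add}(a))$ assigning to each action three subsets of $F$, and a map $M$ assigning to each $c\in\mathcal C$ a finite set of task networks. A \emph{task network} is a triple $(T,\prec^+,\alpha)$ of a finite set $T$ of tasks, a strict partial order $\prec^+$ on $T$, and a map $\alpha\colon T\to A\cup\mathcal C$; it is \emph{primitive} if $\alpha(T)\subseteq A$. A \emph{linearization} is a total order of $T$ extending $\prec^+$. An action $a$ is executable in a state $s\subseteq F$ if $\mathrm{pre}(a)\subseteq s$, and then leads to the state $(s\setminus \mathrm{del}(a))\cup\mathrm{add}(a)$; a plan (a finite sequence of actions) is executable in $s$ if its actions can be executed consecutively starting from $s$. A task $t$ with $\alpha(t)=c\in\mathcal C$ is decomposed by replacing it by a copy of a network in $M(c)$, all of whose tasks inherit the order relations of $t$ to the other tasks. A \emph{full solution} to $(D,tn,s_0)$ is a primitive task network $(T',\prec'^+,\alpha')$ that has a linearization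 whose action sequence is executable in $s_0$, and such that $tn$ decomposes, in finitely many (possibly zero) steps, into a primitive network $(T',\prec^{*+},\alpha')$ with $\prec^{*+}\subseteq\prec'^+$. \textsc{Plan Verification}: given a domain $D$, a task network $tn$ in $D$, a state $s_0\subseteq F$ and a plan $p$ over $A$, is there a full solution to $(D,tn,s_0)$ with a linearization whose action sequence is $p$, where $p$ is executable in $s_0$? The \emph{generalized partial order width} of a task network is the maximum size of an antichain of $\prec^+$ consisting of non-isolated tasks, where a task is isolated if it is incomparable to every other task. \textbf{Theorem.} For every constant $w\in\mathbb N$, \textsc{Plan Verification} is polynomial-time solvable on primitive task networks of generalized partial order width at most $w$: there are a deterministic algorithm and a polynomial $q$ such that, on every input $(D,tn,s_0,p)$ in which $tn$ is primitive and has generalized partial order width at most $w$, the algorithm decides the problem in time at most $q(N)$, where $N$ is the size of the encoded input. -/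

import Mathlib

namespace HTN

/-! ### Computation model: while-programs over binary trees

The data are binary trees. A tree of size `s` is the same thing as a bit string of length `s`
(its preorder listing, one bit per node or leaf). Programs are deterministic and are built from
the basic tree operations by pairing, composition, conditionals and while loops. Every operation
is charged the size of the tree that it works on, and a program has finitely many operations; so
the cost bounds the size of everything that the program writes, and a Turing machine carries out
a computation of cost `t` within a number of steps polynomial in `t`. In the other direction a
Turing machine configuration is a tree on which one step of the machine is a loop-free program. -/

/-- Binary trees. -/
inductive Data : Type
  | nil : Data
  | node : Data → Data → Data

namespace Data

/-- Number of nodes and leaves of a tree. -/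
def size : Data → ℕ
  | nil => 1
  | node l r => size l + size r + 1

/-- The left subtree; `nil` for the empty tree. -/
def left : Data → Data
  | nil => nil
  | node l _ => l

/-- The right subtree; `nil` for the empty tree. -/
def right : Data → Data
  | nil => nil
  | node _ r => r

/-- Truth values. -/
def ofBool : Bool → Data
  | false => nil
  | true => node nil nil

/-- Lists, right-nested. -/
def ofList : List Data → Data
  | [] => nil
  | x :: l => node x (ofList l)

/-- Natural numbers, in unary. -/
def ofNat (n : ℕ) : Data := ofList (List.replicate n nil)

end Data

/-- Programs; each one computes a partial function from trees to trees. -/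
inductive Prog : Type
  /-- the constant `nil` -/
  | nil : Prog
  /-- the input itself -/
  | input : Prog
  /-- the left subtree of the input -/
  | left : Prog
  /-- the right subtree of the input -/
  | right : Prog
  /-- run both programs on the input and join their results -/
  | pair : Prog → Prog → Prog
  /-- run the first program, then the second one on its result -/
  | seq : Prog → Prog → Prog
  /-- `cond c p q`: run `p` if the result of `c` on the input is not `nil`, otherwise `q` -/
  | cond : Prog → Prog → Prog → Prog
  /-- `loop c p`: as long as the result of `c` on the current tree is not `nil`,
  replace the current tree by the result of `p` on it -/
  | loop : Prog → Prog → Prog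

/-- `Prog.Eval p x y t`: on input `x` the program `p` halts with output `y`, at total cost `t`.
Each executed operation adds the size of the tree it is applied to. -/
inductive Prog.Eval : Prog → Data → Data → ℕ → Prop
  | nil (x : Data) : Prog.Eval Prog.nil x Data.nil x.size
  | input (x : Data) : Prog.Eval Prog.input x x x.size
  | left (x : Data) : Prog.Eval Prog.left x x.left x.size
  | right (x : Data) : Prog.Eval Prog.right x x.right x.size
  | pair {p q : Prog} {x y z : Data} {s t : ℕ} :
      Prog.Eval p x y s → Prog.Eval q x z t →
      Prog.Eval (Prog.pair p q) x (Data.node y z) (x.size + s + t)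
  | seq {p q : Prog} {x y z : Data} {s t : ℕ} :
      Prog.Eval p x y s → Prog.Eval q y z t →
      Prog.Eval (Prog.seq p q) x z (x.size + s + t)
  | condTrue {c p q : Prog} {x b y : Data} {s t : ℕ} :
      Prog.Eval c x b s → b ≠ Data.nil → Prog.Eval p x y t →
      Prog.Eval (Prog.cond c p q) x y (x.size + s + t)
  | condFalse {c p q : Prog} {x y : Data} {s t : ℕ} :
      Prog.Eval c x Data.nil s → Prog.Eval q x y t →
      Prog.Eval (Prog.cond c p q) x y (x.size + s + t)
  | loopStep {c p : Prog} {x b y z : Data} {s t u : ℕ} :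
      Prog.Eval c x b s → b ≠ Data.nil → Prog.Eval p x y t →
      Prog.Eval (Prog.loop c p) y z u →
      Prog.Eval (Prog.loop c p) x z (x.size + s + t + u)
  | loopDone {c p : Prog} {x : Data} {s : ℕ} :
      Prog.Eval c x Data.nil s →
      Prog.Eval (Prog.loop c p) x x (x.size + s)

/-- Programs are deterministic: output and cost are determined by the input. -/
theorem Prog.Eval.unique {p : Prog} {x y z : Data} {s t : ℕ}
    (h : Prog.Eval p x y s) (h' : Prog.Eval p x z t) : y = z ∧ s = t := by
  induction h generalizing z t with
  | nil x => cases h'; exact ⟨rfl, rfl⟩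
  | input x => cases h'; exact ⟨rfl, rfl⟩
  | left x => cases h'; exact ⟨rfl, rfl⟩
  | right x => cases h'; exact ⟨rfl, rfl⟩
  | pair _ _ ih1 ih2 =>
    cases h' with
    | pair a b =>
      obtain ⟨rfl, rfl⟩ := ih1 a
      obtain ⟨rfl, rfl⟩ := ih2 b
      exact ⟨rfl, rfl⟩
  | seq _ _ ih1 ih2 =>
    cases h' with
    | seq a b =>
      obtain ⟨rfl, rfl⟩ := ih1 a
      obtain ⟨rfl, rfl⟩ := ih2 b
      exact ⟨rfl, rfl⟩
  | condTrue _ hb _ ih1 ih2 =>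
    cases h' with
    | condTrue a _ b =>
      obtain ⟨rfl, rfl⟩ := ih1 a
      obtain ⟨rfl, rfl⟩ := ih2 b
      exact ⟨rfl, rfl⟩
    | condFalse a _ => exact absurd (ih1 a).1 hb
  | condFalse _ _ ih1 ih2 =>
    cases h' with
    | condTrue a hb _ => exact absurd (ih1 a).1.symm hb
    | condFalse a b =>
      obtain ⟨_, rfl⟩ := ih1 a
      obtain ⟨rfl, rfl⟩ := ih2 b
      exact ⟨rfl, rfl⟩
  | loopStep _ hb _ _ ih1 ih2 ih3 =>
    cases h' with
    | loopStep a _ b c =>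
      obtain ⟨rfl, rfl⟩ := ih1 a
      obtain ⟨rfl, rfl⟩ := ih2 b
      obtain ⟨rfl, rfl⟩ := ih3 c
      exact ⟨rfl, rfl⟩
    | loopDone a => exact absurd (ih1 a).1 hb
  | loopDone _ ih1 =>
    cases h' with
    | loopStep a hb _ _ => exact absurd (ih1 a).1.symm hb
    | loopDone a =>
      obtain ⟨_, rfl⟩ := ih1 a
      exact ⟨rfl, rfl⟩

open Classical in
/-- The decision problem `yes`, with inputs presented by `enc`, is polynomial-time solvable on the
class `K` of instances: one program answers correctly on every instance in `K`, at a cost bounded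
by a fixed polynomial in the size of the encoded instance. -/
def PolyTimeSolvableOn {ι : Type} (enc : ι → Data) (yes : ι → Prop) (K : Set ι) : Prop :=
  ∃ (P : Prog) (q : Polynomial ℕ), ∀ I ∈ K, ∃ t ≤ q.eval (enc I).size,
    Prog.Eval P (enc I) (Data.ofBool (decide (yes I))) t

/-! ### Hierarchical task networks -/

/-- A task network over the actions `A` and the compound task names `C`: finitely many tasks,
a strict partial order `prec` on them, and a name for each task. -/
structure TaskNetwork (A C : Type) where
  card : ℕ
  prec : Fin card → Fin card → Prop
  irrefl : ∀ t, ¬ prec t t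
  trans : ∀ t u v, prec t u → prec u v → prec t v
  label : Fin card → A ⊕ C

namespace TaskNetwork

variable {A C : Type}

/-- The tasks of a network. -/
abbrev Task (tn : TaskNetwork A C) : Type := Fin tn.card

/-- No task is compound. -/
def IsPrimitive (tn : TaskNetwork A C) : Prop := ∀ t, ∃ a : A, tn.label t = Sum.inl a

/-- A total order on the tasks that respects the partial order; `σ i` is the task at position `i`. -/
def IsLinearization (tn : TaskNetwork A C) (σ : Fin tn.card ≃ tn.Task) : Prop :=
  ∀ i j, tn.prec (σ i) (σ j) → i < j

/-- The sequence of names along a linearization. -/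
def word (tn : TaskNetwork A C) (σ : Fin tn.card ≃ tn.Task) : List (A ⊕ C) :=
  List.ofFn fun i => tn.label (σ i)

/-- A task that is incomparable to every other task. -/
def IsIsolated (tn : TaskNetwork A C) (t : tn.Task) : Prop :=
  ∀ u, ¬ tn.prec t u ∧ ¬ tn.prec u t

open Classical in
/-- Generalized partial order width: the largest size of an antichain of non-isolated tasks. -/
noncomputable def gpow (tn : TaskNetwork A C) : ℕ :=
  (Finset.univ.filter fun S : Finset tn.Task =>
    (∀ t ∈ S, ¬ tn.IsIsolated t) ∧ IsAntichain tn.prec (S : Set tn.Task)).sup Finset.card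

/-- `tn'` arises from `tn` by replacing the task `t` by the network `m`: up to the names of the
tasks, the tasks of `tn'` are those of `tn` other than `t` together with those of `m`, and each task
of `m` is related to the tasks outside `m` as `t` was. -/
def Replaces (tn : TaskNetwork A C) (t : tn.Task) (m tn' : TaskNetwork A C) : Prop :=
  ∃ e : ({u : tn.Task // u ≠ t} ⊕ m.Task) ≃ tn'.Task,
    (∀ u, tn'.label (e (Sum.inl u)) = tn.label u) ∧
    (∀ x, tn'.label (e (Sum.inr x)) = m.label x) ∧
    (∀ u v, tn'.prec (e (Sum.inl u)) (e (Sum.inl v)) ↔ tn.prec u v) ∧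
    (∀ x y, tn'.prec (e (Sum.inr x)) (e (Sum.inr y)) ↔ m.prec x y) ∧
    (∀ u x, tn'.prec (e (Sum.inl u)) (e (Sum.inr x)) ↔ tn.prec u t) ∧
    (∀ u x, tn'.prec (e (Sum.inr x)) (e (Sum.inl u)) ↔ tn.prec t u)

end TaskNetwork

/-- A planning domain. The propositions, the actions and the compound task names are numbered;
`pre`, `del`, `add` are the three components of the function assigning effects to actions, and
`methods c` lists the task networks into which `c` can be decomposed. -/
structure Domain where
  numProps : ℕ
  numActions : ℕ
  numCompounds : ℕ
  pre : Fin numActions → Finset (Fin numProps)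
  del : Fin numActions → Finset (Fin numProps)
  add : Fin numActions → Finset (Fin numProps)
  methods : Fin numCompounds → List (TaskNetwork (Fin numActions) (Fin numCompounds))

namespace Domain

/-- States are sets of propositions. -/
abbrev State (D : Domain) : Type := Finset (Fin D.numProps)

/-- The actions of the domain. -/
abbrev Action (D : Domain) : Type := Fin D.numActions

/-- The compound task names of the domain. -/
abbrev Compound (D : Domain) : Type := Fin D.numCompounds

/-- Task networks in the domain. -/
abbrev Network (D : Domain) : Type := TaskNetwork D.Action D.Compound

/-- The actions of the plan can be executed one after the other from the given state. -/
def Executable (D : Domain) : D.State → List D.Action → Prop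
  | _, [] => True
  | s, a :: p => D.pre a ⊆ s ∧ D.Executable ((s \ D.del a) ∪ D.add a) p

/-- One decomposition step: a compound task is replaced by one of the networks of its name. -/
def DecompStep (D : Domain) (tn tn' : D.Network) : Prop :=
  ∃ (t : tn.Task) (c : D.Compound) (m : D.Network),
    tn.label t = Sum.inr c ∧ m ∈ D.methods c ∧ tn.Replaces t m tn'

/-- `tn` can be decomposed into `tn'` by any number of steps. -/
def DecomposesInto (D : Domain) : D.Network → D.Network → Prop :=
  Relation.ReflTransGen D.DecompStep

/-- Some linearization of `tn` has the action sequence `p`. -/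
def LinearizesTo (D : Domain) (tn : D.Network) (p : List D.Action) : Prop :=
  ∃ σ : Fin tn.card ≃ tn.Task, tn.IsLinearization σ ∧ tn.word σ = p.map Sum.inl

/-- `sol` is a full solution to `(D, tn, s₀)`: a primitive network with an executable linearization,
such that `tn` decomposes into a primitive network with the same tasks and the same task names whose
order is contained in that of `sol`. -/
def IsFullSolution (D : Domain) (tn : D.Network) (s₀ : D.State) (sol : D.Network) : Prop :=
  sol.IsPrimitive ∧
  (∃ p, D.LinearizesTo sol p ∧ D.Executable s₀ p) ∧
  ∃ tn' : D.Network, D.DecomposesInto tn tn' ∧ tn'.IsPrimitive ∧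
    ∃ e : tn'.Task ≃ sol.Task,
      (∀ t, sol.label (e t) = tn'.label t) ∧ ∀ t u, tn'.prec t u → sol.prec (e t) (e u)

end Domain

/-! ### Plan verification -/

/-- An input of the plan verification problem. -/
structure Instance where
  D : Domain
  tn : D.Network
  s₀ : D.State
  plan : List D.Action

/-- Plan verification: is there a full solution with a linearization whose action sequence is the
given plan, this plan being executable in the initial state? -/
def PlanVerification (I : Instance) : Prop :=
  ∃ sol : I.D.Network, I.D.IsFullSolution I.tn I.s₀ sol ∧
    I.D.LinearizesTo sol I.plan ∧ I.D.Executable I.s₀ I.plan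

/-! ### Encoding of instances -/

/-- The list of the trees of the values of `f`. -/
def encFn {n : ℕ} (f : Fin n → Data) : Data := Data.ofList (List.ofFn f)

/-- A subset of `Fin n`, as the list of its `n` membership bits. -/
def encSet {n : ℕ} (s : Finset (Fin n)) : Data := encFn fun i => Data.ofBool (decide (i ∈ s))

/-- A task name: a bit that tells actions from compound names, and its number. -/
def encName {a c : ℕ} : Fin a ⊕ Fin c → Data
  | Sum.inl i => Data.node (Data.ofBool false) (Data.ofNat i)
  | Sum.inr i => Data.node (Data.ofBool true) (Data.ofNat i)

open Classical in
/-- A task network: the rows of the 0-1 matrix of its order, and the list of task names. -/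
noncomputable def encNetwork {a c : ℕ} (tn : TaskNetwork (Fin a) (Fin c)) : Data :=
  Data.node
    (encFn fun t => encFn fun u => Data.ofBool (decide (tn.prec t u)))
    (encFn fun t => encName (tn.label t))

/-- A domain: for each action its three sets of propositions, and for each compound name the list of
its networks. -/
noncomputable def encDomain (D : Domain) : Data :=
  Data.node (Data.ofNat D.numProps)
    (Data.node
      (encFn fun a => Data.node (encSet (D.pre a)) (Data.node (encSet (D.del a)) (encSet (D.add a))))
      (encFn fun c => Data.ofList ((D.methods c).map encNetwork)))

/-- An instance: domain, task network, initial state, plan. -/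
noncomputable def encInstance (I : Instance) : Data :=
  Data.node (encDomain I.D)
    (Data.node (encNetwork I.tn)
      (Data.node (encSet I.s₀) (Data.ofList (I.plan.map fun a => Data.ofNat a))))

end HTN

/-!
A primitive network has no compound task, so it decomposes into itself only, and a full solution
with a linearization reading `p` exists if and only if the network itself has such a linearization
(`planVerification_iff`). It remains to decide whether the tasks can be arranged along `p`, and
whether `p` is executable; the latter is a simulation.

For the former, only the non-isolated tasks matter. If the names of all tasks are, with
multiplicities, the letters of `p`, then every arrangement of the non-isolated tasks along a
subsequence of `p` extends to all tasks: the letters that are left over are the names of the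
isolated tasks, which may go anywhere (`TaskNetwork.exists_arrangement_iff`). Whether the
non-isolated tasks can be arranged along a subsequence is found by dynamic programming, reading
`p` from its end. After each letter the *frontier* is the set of those sets of non-isolated tasks,
closed under successors, that can be arranged along a subsequence of the letters read so far. Such
a set is the closure of its minimal elements, an antichain of at most `w` tasks, so that a network
with `n` tasks has at most `(n + 1) ^ w` of them (`TaskNetwork.length_frontier_le`).

That all this is done by a program of polynomial cost is shown with the relation `PolyTime e g`:
some program turns the tree `e i` into the tree `g i` at polynomial cost, uniformly in an index `i`
of an arbitrary type. The relation is closed under composition, pairing, branching, and under folds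
over lists whose intermediate values stay polynomially bounded (`PolyTime.foldl`); inside a fold,
the index type is a sigma type that carries the context, the list element and the accumulator. The
bound on the frontier enters at one place only, the outermost fold, where the index type
carries the promise on the width.
-/

namespace HTN

/-! ### Polynomial-time computability between families of trees -/

/-- Polynomials with natural coefficients are monotone functions. -/
theorem polynomial_eval_mono (q : Polynomial ℕ) {a b : ℕ} (h : a ≤ b) : q.eval a ≤ q.eval b := by
  rw [Polynomial.eval_eq_sum_range, Polynomial.eval_eq_sum_range]
  exact Finset.sum_le_sum fun i _ => Nat.mul_le_mul_left _ (Nat.pow_le_pow_left h i)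

theorem Data.one_le_size (x : Data) : 1 ≤ x.size := by
  cases x <;> simp [Data.size]

theorem Data.size_left_le (x : Data) : x.left.size ≤ x.size := by
  cases x <;> simp [Data.size, Data.left]; omega

theorem Data.size_right_le (x : Data) : x.right.size ≤ x.size := by
  cases x <;> simp [Data.size, Data.right]; omega

/-- The cost of a computation bounds the size of its result. -/
theorem Prog.Eval.size_le {p : Prog} {x y : Data} {t : ℕ} (h : Prog.Eval p x y t) :
    y.size ≤ t := by
  induction h with
  | nil x => exact x.one_le_size
  | input x => exact le_rfl
  | left x => exact x.size_left_le
  | right x => exact x.size_right_le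
  | @pair _ _ x _ _ _ _ _ _ ih1 ih2 =>
    have := x.one_le_size
    simp only [Data.size]; omega
  | _ => omega

/-- `g` is computable from `e` in polynomial time: one program turns `e i` into `g i`, for every
index `i`, at a cost polynomial in the size of `e i`. The indices are arbitrary, so that the
promise of a problem and the invariants of an algorithm can be part of the index type. -/
def PolyTime {ι : Type} (e g : ι → Data) : Prop :=
  ∃ (P : Prog) (q : Polynomial ℕ), ∀ i, ∃ t ≤ q.eval (e i).size, Prog.Eval P (e i) (g i) t

/-- The numbers `g i` are bounded by a polynomial in the size of `e i`. -/
def PolyBdd {ι : Type} (e : ι → Data) (g : ι → ℕ) : Prop :=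
  ∃ q : Polynomial ℕ, ∀ i, g i ≤ q.eval (e i).size

namespace PolyBdd

variable {ι : Type} {e : ι → Data} {g h : ι → ℕ}

theorem const (n : ℕ) : PolyBdd e fun _ => n := ⟨Polynomial.C n, fun _ => by simp⟩

theorem size : PolyBdd e fun i => (e i).size := ⟨Polynomial.X, fun _ => by simp⟩

theorem mono (hg : PolyBdd e g) (hh : ∀ i, h i ≤ g i) : PolyBdd e h := by
  obtain ⟨q, hq⟩ := hg
  exact ⟨q, fun i => (hh i).trans (hq i)⟩

theorem add (hg : PolyBdd e g) (hh : PolyBdd e h) : PolyBdd e fun i => g i + h i := by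
  obtain ⟨q, hq⟩ := hg
  obtain ⟨r, hr⟩ := hh
  exact ⟨q + r, fun i => by rw [Polynomial.eval_add]; exact Nat.add_le_add (hq i) (hr i)⟩

theorem mul (hg : PolyBdd e g) (hh : PolyBdd e h) : PolyBdd e fun i => g i * h i := by
  obtain ⟨q, hq⟩ := hg
  obtain ⟨r, hr⟩ := hh
  exact ⟨q * r, fun i => by rw [Polynomial.eval_mul]; exact Nat.mul_le_mul (hq i) (hr i)⟩

theorem pow (hg : PolyBdd e g) (n : ℕ) : PolyBdd e fun i => g i ^ n := by
  obtain ⟨q, hq⟩ := hg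
  exact ⟨q ^ n, fun i => by rw [Polynomial.eval_pow]; exact Nat.pow_le_pow_left (hq i) n⟩

theorem eval (hg : PolyBdd e g) (r : Polynomial ℕ) : PolyBdd e fun i => r.eval (g i) := by
  obtain ⟨q, hq⟩ := hg
  exact ⟨r.comp q, fun i => by
    rw [Polynomial.eval_comp]; exact polynomial_eval_mono r (hq i)⟩

end PolyBdd

theorem PolyTime.of_polyBdd {ι : Type} {e g : ι → Data} (P : Prog) {c : ι → ℕ}
    (hc : PolyBdd e c) (h : ∀ i, ∃ t ≤ c i, Prog.Eval P (e i) (g i) t) : PolyTime e g := by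
  obtain ⟨q, hq⟩ := hc
  refine ⟨P, q, fun i => ?_⟩
  obtain ⟨t, ht, hP⟩ := h i
  exact ⟨t, ht.trans (hq i), hP⟩

namespace PolyTime

variable {ι κ : Type} {e g h : ι → Data}

theorem size_bdd (hg : PolyTime e g) : PolyBdd e fun i => (g i).size := by
  obtain ⟨P, q, hq⟩ := hg
  refine ⟨q, fun i => ?_⟩
  obtain ⟨t, ht, hP⟩ := hq i
  exact hP.size_le.trans ht

theorem refl : PolyTime e e :=
  of_polyBdd Prog.input PolyBdd.size fun _ => ⟨_, le_rfl, Prog.Eval.input _⟩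

theorem trans (hg : PolyTime e g) (hh : PolyTime g h) : PolyTime e h := by
  have hs := hg.size_bdd
  obtain ⟨P, q, hP⟩ := hg
  obtain ⟨Q, r, hQ⟩ := hh
  refine of_polyBdd (Prog.seq P Q) ((PolyBdd.size.add ⟨q, fun _ => le_rfl⟩).add (hs.eval r))
    fun i => ?_
  obtain ⟨s, hs, hP⟩ := hP i
  obtain ⟨t, ht, hQ⟩ := hQ i
  exact ⟨_, by gcongr, Prog.Eval.seq hP hQ⟩

theorem reindex (hg : PolyTime e g) (φ : κ → ι) :
    PolyTime (fun k => e (φ k)) (fun k => g (φ k)) := by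
  obtain ⟨P, q, hP⟩ := hg
  exact ⟨P, q, fun k => hP (φ k)⟩

theorem nil : PolyTime e fun _ => Data.nil :=
  of_polyBdd Prog.nil PolyBdd.size fun _ => ⟨_, le_rfl, Prog.Eval.nil _⟩

theorem left (hg : PolyTime e g) : PolyTime e fun i => (g i).left :=
  hg.trans (of_polyBdd Prog.left PolyBdd.size fun _ => ⟨_, le_rfl, Prog.Eval.left _⟩)

theorem right (hg : PolyTime e g) : PolyTime e fun i => (g i).right :=
  hg.trans (of_polyBdd Prog.right PolyBdd.size fun _ => ⟨_, le_rfl, Prog.Eval.right _⟩)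

theorem node (hg : PolyTime e g) (hh : PolyTime e h) :
    PolyTime e fun i => Data.node (g i) (h i) := by
  obtain ⟨P, q, hP⟩ := hg
  obtain ⟨Q, r, hQ⟩ := hh
  refine of_polyBdd (Prog.pair P Q)
    ((PolyBdd.size.add ⟨q, fun _ => le_rfl⟩).add ⟨r, fun _ => le_rfl⟩) fun i => ?_
  obtain ⟨s, hs, hP⟩ := hP i
  obtain ⟨t, ht, hQ⟩ := hQ i
  exact ⟨_, by gcongr, Prog.Eval.pair hP hQ⟩

theorem const (d : Data) : PolyTime e fun _ => d := by
  induction d with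
  | nil => exact nil
  | node l r hl hr => exact hl.node hr

/-- Branching on whether an intermediate result is `nil`. -/
theorem cond {c : ι → Data} [∀ i, Decidable (c i = Data.nil)] (hc : PolyTime e c)
    (hg : PolyTime e g) (hh : PolyTime e h) :
    PolyTime e fun i => if c i = Data.nil then g i else h i := by
  obtain ⟨C, p, hC⟩ := hc
  obtain ⟨P, q, hP⟩ := hg
  obtain ⟨Q, r, hQ⟩ := hh
  refine of_polyBdd (Prog.cond C Q P) ((PolyBdd.size.add ⟨p, fun _ => le_rfl⟩).add
    (PolyBdd.add ⟨q, fun _ => le_rfl⟩ ⟨r, fun _ => le_rfl⟩)) fun i => ?_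
  obtain ⟨u, hu, hC⟩ := hC i
  obtain ⟨s, hs, hP⟩ := hP i
  obtain ⟨t, ht, hQ⟩ := hQ i
  by_cases hi : c i = Data.nil
  · rw [if_pos hi]
    rw [hi] at hC
    exact ⟨_, by omega, Prog.Eval.condFalse hC hP⟩
  · rw [if_neg hi]
    exact ⟨_, by omega, Prog.Eval.condTrue hC hi hQ⟩

/-! ### Folds over lists -/

section Foldl

variable {α β : ι → Type}

/-- The loop behind `foldl`. Its state consists of the context `E`, the remaining list and the
accumulator; the condition `c` returns the remaining list, and `p` performs one step. If `Z` bounds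
the size of all states, each pass costs at most `Z + qc.eval Z + qp.eval Z`. -/
theorem exists_eval_loop {E : Data} {A B : Type} {ea : A → Data} {eb : B → Data} {f : B → A → B}
    {c p : Prog} {qc qp : Polynomial ℕ} {Z m : ℕ}
    (hc : ∀ (b : B) (l : List A),
      ∃ t ≤ qc.eval (Data.node E (Data.node (Data.ofList (l.map ea)) (eb b))).size,
        Prog.Eval c (Data.node E (Data.node (Data.ofList (l.map ea)) (eb b)))
          (Data.ofList (l.map ea)) t)
    (hp : ∀ (b : B) (a : A) (l : List A),
      ∃ t ≤ qp.eval (Data.node E (Data.node (Data.ofList ((a :: l).map ea)) (eb b))).size,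
        Prog.Eval p (Data.node E (Data.node (Data.ofList ((a :: l).map ea)) (eb b)))
          (Data.node E (Data.node (Data.ofList (l.map ea)) (eb (f b a)))) t)
    (l : List A) (b : B) (hm : ∀ l', l' <+: l → (eb (l'.foldl f b)).size ≤ m)
    (hZ : E.size + (Data.ofList (l.map ea)).size + m + 2 ≤ Z) :
    ∃ t ≤ (l.length + 1) * (Z + qc.eval Z + qp.eval Z),
      Prog.Eval (Prog.loop c p) (Data.node E (Data.node (Data.ofList (l.map ea)) (eb b)))
        (Data.node E (Data.node Data.nil (eb (l.foldl f b)))) t := by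
  induction l generalizing b with
  | nil =>
    obtain ⟨t, ht, h⟩ := hc b []
    have h0 := hm [] (List.nil_prefix)
    simp only [List.foldl_nil] at h0
    have hs : (Data.node E (Data.node (Data.ofList (([] : List A).map ea)) (eb b))).size ≤ Z := by
      simp only [Data.size] at hZ ⊢; omega
    refine ⟨_, ?_, Prog.Eval.loopDone h⟩
    have := polynomial_eval_mono qc hs
    simp only [List.length_nil, zero_add, one_mul]; omega
  | cons a l ih =>
    obtain ⟨s, hs, h1⟩ := hc b (a :: l)
    obtain ⟨t, ht, h2⟩ := hp b a l
    have h0 := hm [] (List.nil_prefix)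
    simp only [List.foldl_nil] at h0
    have hsz : (Data.node E (Data.node (Data.ofList ((a :: l).map ea)) (eb b))).size ≤ Z := by
      simp only [Data.size] at hZ ⊢; omega
    obtain ⟨u, hu, h3⟩ := ih (f b a)
      (fun l' hl' => hm (a :: l') (List.cons_prefix_cons.2 ⟨rfl, hl'⟩))
      (by simp only [List.map_cons, Data.ofList, Data.size] at hZ ⊢; omega)
    refine ⟨_, ?_, Prog.Eval.loopStep h1 (by simp [Data.ofList]) h2 h3⟩
    have := polynomial_eval_mono qc hsz
    have := polynomial_eval_mono qp hsz
    rw [List.length_cons, add_mul _ 1 (Z + _ + _), one_mul]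
    omega

theorem length_le_size_ofList {A : Type} (ea : A → Data) (l : List A) :
    l.length ≤ (Data.ofList (l.map ea)).size := by
  induction l with
  | nil => simp
  | cons a l ih => simp only [List.map_cons, Data.ofList, Data.size, List.length_cons]; omega

theorem size_le_size_ofList {A : Type} (ea : A → Data) {l : List A} {a : A} (ha : a ∈ l) :
    (ea a).size ≤ (Data.ofList (l.map ea)).size := by
  induction l with
  | nil => simp at ha
  | cons b l ih =>
    simp only [List.map_cons, Data.ofList, Data.size]
    rcases List.mem_cons.1 ha with rfl | h
    · omega
    · have := ih h; omega

/-- A left fold is computable in polynomial time if its step is and if all the intermediate values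
have polynomial size. The step sees the context `e i`, the list element and the accumulator. -/
theorem foldl {l : ∀ i, List (α i)} {init : ∀ i, β i} {f : ∀ i, β i → α i → β i}
    {ea : ∀ i, α i → Data} {eb : ∀ i, β i → Data} {m : ι → ℕ}
    (hl : PolyTime e fun i => Data.ofList ((l i).map (ea i)))
    (hinit : PolyTime e fun i => eb i (init i))
    (hf : PolyTime
      (fun j : Σ i, α i × β i => Data.node (e j.1) (Data.node (ea j.1 j.2.1) (eb j.1 j.2.2)))
      (fun j => eb j.1 (f j.1 j.2.2 j.2.1)))
    (hm : PolyBdd e m)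
    (hsize : ∀ i l', l' <+: l i → (eb i (l'.foldl (f i) (init i))).size ≤ m i) :
    PolyTime e fun i => eb i ((l i).foldl (f i) (init i)) := by
  have hc : PolyTime (fun j : Σ i, β i × List (α i) =>
      Data.node (e j.1) (Data.node (Data.ofList (j.2.2.map (ea j.1))) (eb j.1 j.2.1)))
      (fun j => Data.ofList (j.2.2.map (ea j.1))) := refl.right.left
  have hp : PolyTime (fun j : Σ i, β i × α i × List (α i) =>
      Data.node (e j.1) (Data.node (Data.ofList ((j.2.2.1 :: j.2.2.2).map (ea j.1))) (eb j.1 j.2.1)))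
      (fun j => Data.node (e j.1) (Data.node (Data.ofList (j.2.2.2.map (ea j.1)))
        (eb j.1 (f j.1 j.2.1 j.2.2.1)))) :=
    refl.left.node (refl.right.left.right.node ((refl.left.node
      (refl.right.left.left.node refl.right.right)).trans
        (hf.reindex fun j : Σ i, β i × α i × List (α i) => ⟨j.1, j.2.2.1, j.2.1⟩)))
  obtain ⟨c, qc, hc⟩ := hc
  obtain ⟨p, qp, hp⟩ := hp
  have hstart := (refl (e := e)).node (hl.node hinit)
  refine (hstart.trans (h := fun i => Data.node (e i)
    (Data.node Data.nil (eb i ((l i).foldl (f i) (init i))))) ?_).right.right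
  have hn : PolyBdd (fun i => Data.node (e i)
      (Data.node (Data.ofList ((l i).map (ea i))) (eb i (init i)))) fun i => m i := by
    obtain ⟨q, hq⟩ := hm
    refine ⟨q, fun i => (hq i).trans (polynomial_eval_mono q ?_)⟩
    simp only [Data.size]; omega
  have hZ := PolyBdd.size.add hn
  refine of_polyBdd (Prog.loop c p) ((PolyBdd.size.add (PolyBdd.const 1)).mul
    ((hZ.add (hZ.eval qc)).add (hZ.eval qp))) fun i => ?_
  obtain ⟨t, ht, h⟩ := exists_eval_loop (E := e i) (ea := ea i) (eb := eb i) (f := f i)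
    (fun b l => hc ⟨i, b, l⟩) (fun b a l => hp ⟨i, b, a, l⟩) (l i) (init i) (hsize i)
    (Z := (Data.node (e i) (Data.node (Data.ofList ((l i).map (ea i))) (eb i (init i)))).size + m i)
    (by simp only [Data.size]; omega)
  refine ⟨t, ht.trans (Nat.mul_le_mul_right _ ?_), h⟩
  have := length_le_size_ofList (ea i) (l i)
  simp only [Data.size]; omega

theorem foldl_le_add {A B : Type} {f : B → A → B} {m : ℕ} (s : B → ℕ) (l : List A)
    (h : ∀ b, ∀ a ∈ l, s (f b a) ≤ s b + m) (b : B) : s (l.foldl f b) ≤ s b + l.length * m := by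
  induction l generalizing b with
  | nil => simp
  | cons a l ih =>
    have h1 := ih (fun b x hx => h b x (List.mem_cons_of_mem _ hx)) (f b a)
    have h2 := h b a List.mem_cons_self
    rw [List.foldl_cons, List.length_cons, add_mul, one_mul]
    omega

/-- A left fold is computable in polynomial time if its step is and if each step enlarges the
accumulator by a polynomially bounded amount at most. -/
theorem foldl_of_add {l : ∀ i, List (α i)} {init : ∀ i, β i} {f : ∀ i, β i → α i → β i}
    {ea : ∀ i, α i → Data} {eb : ∀ i, β i → Data} {m : ι → ℕ}
    (hl : PolyTime e fun i => Data.ofList ((l i).map (ea i)))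
    (hinit : PolyTime e fun i => eb i (init i))
    (hf : PolyTime
      (fun j : Σ i, α i × β i => Data.node (e j.1) (Data.node (ea j.1 j.2.1) (eb j.1 j.2.2)))
      (fun j => eb j.1 (f j.1 j.2.2 j.2.1)))
    (hm : PolyBdd e m)
    (hsize : ∀ i b, ∀ a ∈ l i, (eb i (f i b a)).size ≤ (eb i b).size + m i) :
    PolyTime e fun i => eb i ((l i).foldl (f i) (init i)) := by
  refine foldl hl hinit hf (hinit.size_bdd.add (hl.size_bdd.mul hm)) fun i l' hl' => ?_
  refine (foldl_le_add (fun b => (eb i b).size) l'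
    (fun b a ha => hsize i b a (hl'.subset ha)) (init i)).trans ?_
  have h1 := hl'.length_le
  have h2 := length_le_size_ofList (ea i) (l i)
  have := Nat.mul_le_mul_right (m i) (h1.trans h2)
  omega

end Foldl

end PolyTime

/-! ### Properties decidable in polynomial time -/

open Classical in
/-- The property `P` of the index can be decided from `e` in polynomial time. -/
def PolyDec {ι : Type} (e : ι → Data) (P : ι → Prop) : Prop :=
  PolyTime e fun i => Data.ofBool (decide (P i))

namespace PolyDec

variable {ι κ : Type} {e : ι → Data} {P Q : ι → Prop}

theorem iff_polyTime [∀ i, Decidable (P i)] :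
    PolyDec e P ↔ PolyTime e fun i => Data.ofBool (decide (P i)) := by
  unfold PolyDec
  convert Iff.rfl

theorem congr (hP : PolyDec e P) (h : ∀ i, Q i ↔ P i) : PolyDec e Q := by
  rwa [show Q = P from funext fun i => propext (h i)]

theorem ite [∀ i, Decidable (P i)] {g h : ι → Data} (hP : PolyDec e P) (hg : PolyTime e g)
    (hh : PolyTime e h) : PolyTime e fun i => if P i then g i else h i := by
  classical
  convert PolyTime.cond (iff_polyTime.1 hP) hh hg using 2 with i
  by_cases hi : P i <;> simp [hi, Data.ofBool]

theorem const (p : Prop) : PolyDec e fun _ => p := PolyTime.const _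

theorem not (hP : PolyDec e P) : PolyDec e fun i => ¬ P i := by
  classical
  rw [iff_polyTime]
  convert hP.ite (PolyTime.const (Data.ofBool false)) (PolyTime.const (Data.ofBool true))
    using 2 with i
  by_cases hi : P i <;> simp [hi]

theorem and (hP : PolyDec e P) (hQ : PolyDec e Q) : PolyDec e fun i => P i ∧ Q i := by
  classical
  rw [iff_polyTime]
  convert hP.ite (iff_polyTime.1 hQ) (PolyTime.const (Data.ofBool false)) using 2 with i
  by_cases hi : P i <;> simp [hi]

theorem or (hP : PolyDec e P) (hQ : PolyDec e Q) : PolyDec e fun i => P i ∨ Q i :=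
  (hP.not.and hQ.not).not.congr fun i => by tauto

theorem imp (hP : PolyDec e P) (hQ : PolyDec e Q) : PolyDec e fun i => P i → Q i :=
  (hP.and hQ.not).not.congr fun i => by tauto

theorem eq_nil {g : ι → Data} (hg : PolyTime e g) : PolyDec e fun i => g i = Data.nil := by
  classical
  rw [iff_polyTime]
  convert hg.cond (PolyTime.const (Data.ofBool true)) (PolyTime.const (Data.ofBool false))
    using 2 with i
  by_cases hi : g i = Data.nil <;> simp [hi]

theorem reindex (hP : PolyDec e P) (φ : κ → ι) : PolyDec (fun k => e (φ k)) fun k => P (φ k) :=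
  PolyTime.reindex hP φ

theorem of_trans {g : ι → Data} (hP : PolyDec g P) (hg : PolyTime e g) : PolyDec e P :=
  hg.trans hP

end PolyDec

/-! ### Lists, numbers and tables -/

theorem Data.size_ofBool_le (b : Bool) : (Data.ofBool b).size ≤ 3 := by
  cases b <;> simp [Data.ofBool, Data.size]

theorem Data.size_ofNat (n : ℕ) : (Data.ofNat n).size = 2 * n + 1 := by
  induction n with
  | zero => rfl
  | succ n ih =>
    change Data.size (Data.node Data.nil (Data.ofNat n)) = _
    simp only [Data.size, ih]; omega

theorem Data.ofNat_eq_map (n : ℕ) :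
    Data.ofNat n = Data.ofList ((List.replicate n ()).map fun _ => Data.nil) := by
  simp [Data.ofNat]

theorem Data.ofNat_pred (n : ℕ) : Data.ofNat (n - 1) = (Data.ofNat n).right := by
  cases n <;> rfl

theorem Data.ofNat_eq_nil {n : ℕ} : Data.ofNat n = Data.nil ↔ n = 0 := by
  cases n <;> simp [Data.ofNat, Data.ofList, List.replicate_succ]

namespace PolyTime

variable {ι : Type} {e : ι → Data}

section Lists

variable {α : ι → Type} {l : ∀ i, List (α i)} {ea : ∀ i, α i → Data}

/-- What is computable from the context is computable from the context and a further value. -/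
theorem lift {g : ι → Data} {e' : (Σ i, α i) → Data} (hg : PolyTime e g)
    (h : ∀ j, (e' j).left = e j.1 := by exact fun _ => rfl) : PolyTime e' fun j => g j.1 := by
  refine (refl.left (e := e')).trans ?_
  simpa only [h] using hg.reindex (Sigma.fst : (Σ i, α i) → ι)

theorem reverse (hl : PolyTime e fun i => Data.ofList ((l i).map (ea i))) :
    PolyTime e fun i => Data.ofList ((l i).reverse.map (ea i)) := by
  have := foldl_of_add (init := fun _ => []) (β := fun i => List (α i))
    (eb := fun i l => Data.ofList (l.map (ea i))) (f := fun i acc a => a :: acc) hl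
    (const (Data.ofList [])) (refl.right.left.node refl.right.right)
    (hl.size_bdd.add (PolyBdd.const 1)) (by
      intro i b a ha
      have := size_le_size_ofList (ea i) ha
      simp only [List.map_cons, Data.ofList, Data.size]
      omega)
  convert this using 4 with i
  have h : ∀ (l acc : List (α i)), l.foldl (fun acc a => a :: acc) acc = l.reverse ++ acc := by
    intro l
    induction l with
    | nil => simp
    | cons a l ih => intro acc; simp [ih]
  simp [h]

theorem map {f : ∀ i, α i → Data} (hl : PolyTime e fun i => Data.ofList ((l i).map (ea i)))
    (hf : PolyTime (fun j : Σ i, α i => Data.node (e j.1) (ea j.1 j.2)) fun j => f j.1 j.2) :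
    PolyTime e fun i => Data.ofList ((l i).map (f i)) := by
  obtain ⟨q, hq⟩ := hf.size_bdd
  have := foldl_of_add (init := fun _ => []) (β := fun _ => List Data)
    (eb := fun _ => Data.ofList) (f := fun i acc a => f i a :: acc) hl.reverse
    (const (Data.ofList []))
    (((refl.left.node refl.right.left).trans
      (hf.reindex fun j : Σ i, α i × List Data => ⟨j.1, j.2.1⟩)).node refl.right.right)
    (((((PolyBdd.size (e := e)).add hl.size_bdd).add (PolyBdd.const 1)).eval q).add
      (PolyBdd.const 1)) (by
      intro i b a ha
      have h1 := size_le_size_ofList (ea i) (List.mem_reverse.1 ha)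
      have h2 : (f i a).size ≤ q.eval (Data.node (e i) (ea i a)).size := hq ⟨i, a⟩
      have h3 := polynomial_eval_mono q (a := (Data.node (e i) (ea i a)).size)
        (b := (e i).size + (Data.ofList ((l i).map (ea i))).size + 1)
        (by simp only [Data.size]; omega)
      have h4 := h2.trans h3
      simp only [Data.ofList, Data.size]
      omega)
  convert this using 3 with i
  have h : ∀ (l : List (α i)) (acc : List Data),
      l.foldl (fun acc a => f i a :: acc) acc = (l.map (f i)).reverse ++ acc := by
    intro l
    induction l with
    | nil => simp
    | cons a l ih => intro acc; simp [ih]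
  simp [h]

theorem length (hl : PolyTime e fun i => Data.ofList ((l i).map (ea i))) :
    PolyTime e fun i => Data.ofNat (l i).length := by
  convert hl.map (f := fun _ _ => Data.nil) nil using 2 with i
  simp [Data.ofNat, List.map_const']

theorem countP {p : ∀ i, α i → Bool} (hl : PolyTime e fun i => Data.ofList ((l i).map (ea i)))
    (hp : PolyDec (fun j : Σ i, α i => Data.node (e j.1) (ea j.1 j.2)) fun j => p j.1 j.2) :
    PolyTime e fun i => Data.ofNat ((l i).countP (p i)) := by
  have := foldl_of_add (init := fun _ => 0) (β := fun _ => ℕ)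
    (eb := fun _ => Data.ofNat) (f := fun i n a => if p i a then n + 1 else n) hl
    (const (Data.ofNat 0)) (by
      have h1 : PolyDec (fun j : Σ i, α i × ℕ => Data.node (e j.1)
          (Data.node (ea j.1 j.2.1) (Data.ofNat j.2.2))) fun j => p j.1 j.2.1 :=
        (hp.reindex fun j : Σ i, α i × ℕ => ⟨j.1, j.2.1⟩).of_trans
          (refl.left.node refl.right.left)
      convert h1.ite (nil.node refl.right.right) refl.right.right using 2 with j
      split_ifs <;> rfl)
    (PolyBdd.const 2) (by
      intro i b a _
      simp only [Data.size_ofNat]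
      split_ifs <;> omega)
  convert this using 3 with i
  have h : ∀ (l : List (α i)) (n : ℕ),
      l.foldl (fun n a => if p i a then n + 1 else n) n = n + l.countP (p i) := by
    intro l
    induction l with
    | nil => simp
    | cons a l ih =>
      intro n
      rw [List.foldl_cons, ih, List.countP_cons]
      split_ifs <;> omega
  rw [h, zero_add]

end Lists

/-- Iteration of a function that enlarges its argument by a polynomially bounded amount at most. -/
theorem iterate {β : ι → Type} {eb : ∀ i, β i → Data} {f : ∀ i, β i → β i} {init : ∀ i, β i}
    {n m : ι → ℕ} (hn : PolyTime e fun i => Data.ofNat (n i))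
    (hinit : PolyTime e fun i => eb i (init i))
    (hf : PolyTime (fun j : Σ i, β i => Data.node (e j.1) (eb j.1 j.2))
      fun j => eb j.1 (f j.1 j.2))
    (hm : PolyBdd e m) (hsize : ∀ i b, (eb i (f i b)).size ≤ (eb i b).size + m i) :
    PolyTime e fun i => eb i ((f i)^[n i] (init i)) := by
  have := foldl_of_add (α := fun _ => Unit) (ea := fun _ _ => Data.nil)
    (l := fun i => List.replicate (n i) ()) (f := fun i b _ => f i b)
    (by simpa only [Data.ofNat_eq_map] using hn) hinit
    ((refl.left.node refl.right.right).trans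
      (hf.reindex fun j : Σ i, Unit × β i => ⟨j.1, j.2.2⟩)) hm (fun i b _ _ => hsize i b)
  convert this using 3 with i
  generalize init i = b
  induction n i generalizing b with
  | zero => rfl
  | succ k ih => rw [Function.iterate_succ_apply, ih, List.replicate_succ, List.foldl_cons]

theorem natSub {a b : ι → ℕ} (ha : PolyTime e fun i => Data.ofNat (a i))
    (hb : PolyTime e fun i => Data.ofNat (b i)) :
    PolyTime e fun i => Data.ofNat (a i - b i) := by
  have := iterate (f := fun _ => Nat.pred) hb ha
    (by simp only [Nat.pred_eq_sub_one, Data.ofNat_pred]; exact refl.right.right)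
    (PolyBdd.const 0) (fun i b => by simp only [Nat.pred_eq_sub_one, Data.size_ofNat]; omega)
  simpa only [Nat.pred_iterate] using this

/-- The numbers below a given one, in order, found by counting down. -/
theorem finRange {n : ι → ℕ} (hn : PolyTime e fun i => Data.ofNat (n i)) :
    PolyTime e fun i =>
      Data.ofList ((List.finRange (n i)).map fun k : Fin (n i) => Data.ofNat k) := by
  have := iterate (β := fun i => {s : ℕ × List ℕ // s.1 ≤ n i})
    (eb := fun i s => Data.node (Data.ofNat s.1.1) (Data.ofList (s.1.2.map Data.ofNat)))
    (f := fun i s => ⟨(s.1.1 - 1, (s.1.1 - 1) :: s.1.2), by have := s.2; dsimp only; omega⟩)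
    (init := fun i => ⟨(n i, []), le_rfl⟩) (m := fun i => (Data.ofNat (n i)).size + 2) hn
    (hn.node (const (Data.ofList [])))
    (by
      simp only [List.map_cons, Data.ofList, Data.ofNat_pred]
      exact refl.right.left.right.node (refl.right.left.right.node refl.right.right))
    (hn.size_bdd.add (PolyBdd.const 2))
    (fun i s => by
      have := s.2
      simp only [List.map_cons, Data.ofList, Data.size, Data.size_ofNat]; omega)
  convert this.right using 2 with i
  rw [Data.right]
  have h : ∀ k (s : {s : ℕ × List ℕ // s.1 ≤ n i}), s.1.1 = k →
      ((fun s : {s : ℕ × List ℕ // s.1 ≤ n i} => (⟨(s.1.1 - 1, (s.1.1 - 1) :: s.1.2), by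
        have := s.2; dsimp only; omega⟩ : {s : ℕ × List ℕ // s.1 ≤ n i}))^[k] s).1.2 =
        List.range k ++ s.1.2 := by
    intro k
    induction k with
    | zero => simp
    | succ k ih =>
      intro s hs
      rw [Function.iterate_succ_apply, ih _ (by simp [hs]), List.range_succ]
      simp [hs]
  rw [h (n i) _ rfl, List.append_nil, ← List.map_coe_finRange_eq_range, List.map_map]
  rfl

/-- Building a table. -/
theorem tabulate {n : ι → ℕ} {v : ∀ i, Fin (n i) → Data} (hn : PolyTime e fun i => Data.ofNat (n i))
    (hv : PolyTime (fun j : Σ i, Fin (n i) => Data.node (e j.1) (Data.ofNat j.2))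
      fun j => v j.1 j.2) :
    PolyTime e fun i => encFn (v i) := by
  have := (finRange hn).map hv
  simpa only [encFn, List.ofFn_eq_map] using this

theorem card_of_encFn {n : ι → ℕ} {v : ∀ i, Fin (n i) → Data}
    (hv : PolyTime e fun i => encFn (v i)) : PolyTime e fun i => Data.ofNat (n i) := by
  have := length (α := fun _ => Data) (l := fun i => List.ofFn (v i)) (ea := fun _ d => d)
    (by simp only [List.map_id']; exact hv)
  simpa only [List.length_ofFn] using this

/-- Reading an entry of a table. -/
theorem get {n : ι → ℕ} {v : ∀ i, Fin (n i) → Data} {k : ∀ i, Fin (n i)}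
    (hv : PolyTime e fun i => encFn (v i)) (hk : PolyTime e fun i => Data.ofNat (k i)) :
    PolyTime e fun i => v i (k i) := by
  have := iterate (β := fun _ => Data) (eb := fun _ d => d) (f := fun _ => Data.right) hk hv
    refl.right.right (PolyBdd.const 0) (fun _ d => d.size_right_le)
  convert this.left using 2 with i
  have h : ∀ (k : ℕ) (l : List Data), Data.right^[k] (Data.ofList l) = Data.ofList (l.drop k) := by
    intro k
    induction k with
    | zero => simp
    | succ k ih =>
      intro l
      rw [Function.iterate_succ_apply]
      cases l with
      | nil => simpa [Data.ofList, Data.right] using ih []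
      | cons a l => simpa [Data.ofList, Data.right] using ih l
  rw [encFn, h, List.drop_eq_getElem_cons (by simp)]
  simp [Data.ofList, Data.left]

end PolyTime

namespace PolyDec

variable {ι : Type} {e : ι → Data}

section Lists

variable {α : ι → Type} {l : ∀ i, List (α i)} {ea : ∀ i, α i → Data} {P : ∀ i, α i → Prop}

theorem nat_le {a b : ι → ℕ} (ha : PolyTime e fun i => Data.ofNat (a i))
    (hb : PolyTime e fun i => Data.ofNat (b i)) : PolyDec e fun i => a i ≤ b i :=
  (eq_nil (ha.natSub hb)).congr fun i => by rw [Data.ofNat_eq_nil]; omega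

theorem nat_eq {a b : ι → ℕ} (ha : PolyTime e fun i => Data.ofNat (a i))
    (hb : PolyTime e fun i => Data.ofNat (b i)) : PolyDec e fun i => a i = b i :=
  ((nat_le ha hb).and (nat_le hb ha)).congr fun i => by omega

theorem fin_eq {n : ι → ℕ} {a b : ∀ i, Fin (n i)} (ha : PolyTime e fun i => Data.ofNat (a i))
    (hb : PolyTime e fun i => Data.ofNat (b i)) : PolyDec e fun i => a i = b i :=
  (nat_eq ha hb).congr fun _ => Fin.ext_iff

theorem exists_mem (hl : PolyTime e fun i => Data.ofList ((l i).map (ea i)))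
    (hP : PolyDec (fun j : Σ i, α i => Data.node (e j.1) (ea j.1 j.2)) fun j => P j.1 j.2) :
    PolyDec e fun i => ∃ a ∈ l i, P i a := by
  classical
  have := PolyTime.countP (p := fun i a => decide (P i a)) hl (hP.congr fun j => by simp)
  exact (eq_nil this).not.congr fun i => by
    rw [Data.ofNat_eq_nil, List.countP_eq_zero]
    simp

theorem forall_mem (hl : PolyTime e fun i => Data.ofList ((l i).map (ea i)))
    (hP : PolyDec (fun j : Σ i, α i => Data.node (e j.1) (ea j.1 j.2)) fun j => P j.1 j.2) :
    PolyDec e fun i => ∀ a ∈ l i, P i a :=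
  (exists_mem (P := fun i a => ¬ P i a) hl hP.not).not.congr fun i => by simp

end Lists

section Fin

variable {n : ι → ℕ} {P : ∀ i, Fin (n i) → Prop}

theorem forall_fin (hn : PolyTime e fun i => Data.ofNat (n i))
    (hP : PolyDec (fun j : Σ i, Fin (n i) => Data.node (e j.1) (Data.ofNat j.2))
      fun j => P j.1 j.2) : PolyDec e fun i => ∀ k, P i k :=
  (forall_mem (PolyTime.finRange hn) hP).congr fun i => by simp

/-- Membership in a set that is given by a table of truth values. -/
theorem mem_encSet {s : ∀ i, Finset (Fin (n i))} {k : ∀ i, Fin (n i)}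
    (hs : PolyTime e fun i => encSet (s i)) (hk : PolyTime e fun i => Data.ofNat (k i)) :
    PolyDec e fun i => k i ∈ s i :=
  iff_polyTime.2 (PolyTime.get hs hk)

variable {s t : ∀ i, Finset (Fin (n i))}

theorem encSet_subset (hs : PolyTime e fun i => encSet (s i))
    (ht : PolyTime e fun i => encSet (t i)) : PolyDec e fun i => s i ⊆ t i := by
  refine (forall_fin (P := fun i k => k ∈ s i → k ∈ t i) hs.card_of_encFn ?_).congr
    fun i => Iff.rfl
  let e' := fun j : Σ i, Fin (n i) => Data.node (e j.1) (Data.ofNat j.2)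
  have hk : PolyTime e' fun j => Data.ofNat j.2 := PolyTime.refl.right
  have hs' : PolyTime e' fun j => encSet (s j.1) := hs.lift
  have ht' : PolyTime e' fun j => encSet (t j.1) := ht.lift
  exact (mem_encSet hs' hk).imp (mem_encSet ht' hk)

theorem encSet_eq (hs : PolyTime e fun i => encSet (s i))
    (ht : PolyTime e fun i => encSet (t i)) : PolyDec e fun i => s i = t i :=
  ((encSet_subset hs ht).and (encSet_subset ht hs)).congr fun _ => subset_antisymm_iff

end Fin

end PolyDec

namespace PolyTime

variable {ι : Type} {e : ι → Data} {n : ι → ℕ} {s : ∀ i, Finset (Fin (n i))}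

theorem tabulateSet (hn : PolyTime e fun i => Data.ofNat (n i))
    (hs : PolyDec (fun j : Σ i, Fin (n i) => Data.node (e j.1) (Data.ofNat j.2))
      fun j => j.2 ∈ s j.1) : PolyTime e fun i => encSet (s i) :=
  tabulate hn (PolyDec.iff_polyTime.1 hs)

end PolyTime

theorem size_encSet_le {n : ℕ} (s : Finset (Fin n)) : (encSet s).size ≤ 4 * n + 1 := by
  have h : ∀ l : List Bool, (Data.ofList (l.map Data.ofBool)).size ≤ 4 * l.length + 1 := by
    intro l
    induction l with
    | nil => simp [Data.ofList, Data.size]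
    | cons b l ih =>
      have := Data.size_ofBool_le b
      simp only [List.map_cons, Data.ofList, Data.size, List.length_cons]
      omega
  have := h (List.ofFn fun i => decide (i ∈ s))
  rwa [List.map_ofFn, List.length_ofFn] at this

/-! ### The frontier of a plan -/

/-- Put an element in front of a list unless it is there already. -/
def insertNew {α : Type} [DecidableEq α] (F : List α) (x : α) : List α :=
  if x ∈ F then F else x :: F

theorem mem_insertNew {α : Type} [DecidableEq α] {F : List α} {x y : α} :
    y ∈ insertNew F x ↔ y ∈ F ∨ y = x := by
  unfold insertNew
  split_ifs with h
  · exact ⟨Or.inl, fun h' => h'.elim id fun e => e ▸ h⟩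
  · rw [List.mem_cons, or_comm]

theorem nodup_insertNew {α : Type} [DecidableEq α] {F : List α} {x : α} (h : F.Nodup) :
    (insertNew F x).Nodup := by
  unfold insertNew
  split_ifs with hx
  · exact h
  · exact List.nodup_cons.2 ⟨hx, h⟩

theorem mem_foldl_iff {α β : Type} {f : List β → α → List β} {R : α → β → Prop}
    (h : ∀ G x y, y ∈ f G x ↔ y ∈ G ∨ R x y) (l : List α) (G : List β) (y : β) :
    y ∈ l.foldl f G ↔ y ∈ G ∨ ∃ x ∈ l, R x y := by
  induction l generalizing G with
  | nil => simp
  | cons a l ih => rw [List.foldl_cons, ih, h]; simp [or_assoc]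

theorem nodup_foldl {α β : Type} {f : List β → α → List β}
    (h : ∀ G x, G.Nodup → (f G x).Nodup) (l : List α) {G : List β} (hG : G.Nodup) :
    (l.foldl f G).Nodup := by
  induction l generalizing G with
  | nil => exact hG
  | cons a l ih => exact ih (h G a hG)

namespace TaskNetwork

variable {A C : Type} (tn : TaskNetwork A C) (lab : tn.Task → A)

/-- The task `t` carries the name `a` and may be put in front of an arrangement of the non-isolated
tasks in `X`: all its successors are in `X`. -/
def CanPrepend (a : A) (X : Finset tn.Task) (t : tn.Task) : Prop :=
  t ∉ X ∧ lab t = a ∧ ¬ tn.IsIsolated t ∧ ∀ u, tn.prec t u → u ∈ X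

open Classical in
/-- Add to the list `G` all the sets that arise from `X` by prepending a task with the name `a`. -/
noncomputable def extend (a : A) (G : List (Finset tn.Task)) (X : Finset tn.Task) :
    List (Finset tn.Task) :=
  (List.finRange tn.card).foldl
    (fun G t => if tn.CanPrepend lab a X t then insertNew G (insert t X) else G) G

/-- The sets that can be reached from those in `F` by reading one more letter `a`, either skipping
it or using it for a non-isolated task. -/
noncomputable def frontierStep (F : List (Finset tn.Task)) (a : A) : List (Finset tn.Task) :=
  F.foldl (tn.extend lab a) F

/-- The sets of non-isolated tasks that can be arranged, respecting the order, along a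
subsequence of the plan, and that contain all successors of their members. Plans are read from
their last action to the first one. -/
noncomputable def frontier (p : List A) : List (Finset tn.Task) :=
  p.reverse.foldl (tn.frontierStep lab) [∅]

theorem frontier_cons (a : A) (p : List A) :
    tn.frontier lab (a :: p) = tn.frontierStep lab (tn.frontier lab p) a := by
  simp [frontier]

theorem mem_extend {a : A} {G : List (Finset tn.Task)} {X Y : Finset tn.Task} :
    Y ∈ tn.extend lab a G X ↔ Y ∈ G ∨ ∃ t, tn.CanPrepend lab a X t ∧ Y = insert t X := by
  unfold extend
  rw [mem_foldl_iff (R := fun t Y => tn.CanPrepend lab a X t ∧ Y = insert t X)]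
  · simp
  · intro G t Y
    split_ifs with h
    · simp [mem_insertNew, h]
    · simp [h]

theorem mem_frontier_cons {a : A} {p : List A} {Y : Finset tn.Task} :
    Y ∈ tn.frontier lab (a :: p) ↔ Y ∈ tn.frontier lab p ∨
      ∃ X ∈ tn.frontier lab p, ∃ t, tn.CanPrepend lab a X t ∧ Y = insert t X := by
  rw [frontier_cons, frontierStep]
  exact mem_foldl_iff (R := fun X Y => ∃ t, tn.CanPrepend lab a X t ∧ Y = insert t X)
    (fun G X Y => tn.mem_extend lab) _ _ _

theorem mem_frontier_nil {Y : Finset tn.Task} : Y ∈ tn.frontier lab [] ↔ Y = ∅ := by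
  simp [frontier]

theorem nodup_frontier (p : List A) : (tn.frontier lab p).Nodup := by
  refine nodup_foldl (fun F a hF => nodup_foldl (fun G X hG => nodup_foldl (fun G t hG => ?_) _ hG)
    _ hF) _ (List.nodup_singleton _)
  split_ifs
  · exact nodup_insertNew hG
  · exact hG

/-- The members of a frontier consist of non-isolated tasks and are closed under successors. -/
theorem closed_of_mem_frontier {p : List A} {X : Finset tn.Task} (hX : X ∈ tn.frontier lab p) :
    ∀ t ∈ X, ¬ tn.IsIsolated t ∧ ∀ u, tn.prec t u → u ∈ X := by
  induction p generalizing X with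
  | nil =>
    rw [mem_frontier_nil] at hX
    simp [hX]
  | cons a p ih =>
    rcases (tn.mem_frontier_cons lab).1 hX with h | ⟨Y, hY, t, ht, rfl⟩
    · exact ih h
    · intro u hu
      rcases Finset.mem_insert.1 hu with rfl | hu
      · exact ⟨ht.2.2.1, fun v hv => Finset.mem_insert_of_mem (ht.2.2.2 v hv)⟩
      · exact ⟨(ih hY u hu).1, fun v hv => Finset.mem_insert_of_mem ((ih hY u hu).2 v hv)⟩

/-! ### The size of the frontier -/

open Classical in
/-- A set of non-isolated tasks that is closed under successors is the closure of its minimal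
elements, which form an antichain; so there are at most `(n + 1) ^ w` such sets. -/
theorem length_frontier_le {w : ℕ} (hw : tn.gpow ≤ w) (p : List A) :
    (tn.frontier lab p).length ≤ (tn.card + 1) ^ w := by
  let Φ : (Fin w → Option tn.Task) → Finset tn.Task := fun f =>
    Finset.univ.filter fun u => ∃ j x, f j = some x ∧ (x = u ∨ tn.prec x u)
  have hΦ : (tn.frontier lab p).toFinset ⊆ Finset.univ.image Φ := by
    intro X hX
    have hcl := tn.closed_of_mem_frontier lab (List.mem_toFinset.1 hX)
    let M := X.filter fun x => ∀ y ∈ X, ¬ tn.prec y x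
    have hM : M.card ≤ w := by
      refine le_trans (Finset.le_sup (f := Finset.card) (Finset.mem_filter.2
        ⟨Finset.mem_univ M, fun t ht => ?_, fun t ht u hu _ h => ?_⟩)) hw
      · exact (hcl t (Finset.mem_filter.1 ht).1).1
      · exact (Finset.mem_filter.1 hu).2 t (Finset.mem_filter.1 ht).1 h
    have hmin : ∀ u ∈ X, ∃ x ∈ M, x = u ∨ tn.prec x u := by
      have : IsTrans tn.Task tn.prec := ⟨tn.trans⟩
      have : Std.Irrefl tn.prec := ⟨tn.irrefl⟩
      have wf : WellFounded tn.prec := Finite.wellFounded_of_trans_of_irrefl _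
      intro u
      induction u using wf.induction with
      | _ u ih =>
        intro hu
        by_cases h : ∀ y ∈ X, ¬ tn.prec y u
        · exact ⟨u, Finset.mem_filter.2 ⟨hu, h⟩, Or.inl rfl⟩
        · push Not at h
          obtain ⟨y, hy, hyu⟩ := h
          obtain ⟨x, hx, h⟩ := ih y hyu hy
          refine ⟨x, hx, Or.inr ?_⟩
          rcases h with rfl | h
          · exact hyu
          · exact tn.trans _ _ _ h hyu
    refine Finset.mem_image.2 ⟨fun j => if h : (j : ℕ) < M.card then
      some (M.equivFin.symm ⟨j, h⟩ : tn.Task) else none, Finset.mem_univ _, ?_⟩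
    ext u
    simp only [Φ, Finset.mem_filter, Finset.mem_univ, true_and]
    constructor
    · rintro ⟨j, x, hj, h⟩
      split_ifs at hj with hlt
      have hx : x ∈ X := by
        rw [← Option.some.inj hj]
        exact (Finset.mem_filter.1 (M.equivFin.symm ⟨j, hlt⟩).2).1
      rcases h with rfl | h
      · exact hx
      · exact (hcl x hx).2 u h
    · intro hu
      obtain ⟨x, hx, h⟩ := hmin u hu
      refine ⟨⟨M.equivFin ⟨x, hx⟩, (M.equivFin ⟨x, hx⟩).2.trans_le hM⟩, x, ?_, h⟩
      simp
  calc (tn.frontier lab p).length = (tn.frontier lab p).toFinset.card :=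
        (List.toFinset_card_of_nodup (tn.nodup_frontier lab p)).symm
    _ ≤ (Finset.univ.image Φ).card := Finset.card_le_card hΦ
    _ ≤ Fintype.card (Fin w → Option tn.Task) := Finset.card_image_le
    _ = (tn.card + 1) ^ w := by simp

/-! ### Arrangements of the tasks along a plan -/

/-- Linearizations, listed as sequences of all the tasks. -/
theorem exists_linearization_iff {p : List A} (hlab : ∀ t, tn.label t = Sum.inl (lab t)) :
    (∃ σ : Fin tn.card ≃ tn.Task, tn.IsLinearization σ ∧ tn.word σ = p.map Sum.inl) ↔
      ∃ L : List tn.Task, L.Nodup ∧ (∀ t, t ∈ L) ∧ L.Pairwise (fun t u => ¬ tn.prec u t) ∧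
        L.map lab = p := by
  constructor
  · rintro ⟨σ, hσ, hp⟩
    refine ⟨List.ofFn σ, List.nodup_ofFn.2 σ.injective, fun t => ?_, ?_, ?_⟩
    · rw [List.mem_ofFn]; exact σ.surjective t
    · rw [List.pairwise_ofFn]
      exact fun i j hij h => absurd (hσ _ _ h) (not_lt.2 hij.le)
    · apply List.map_injective_iff.2 (Sum.inl_injective (β := C))
      rw [← hp, List.map_map, List.map_ofFn, word]
      congr 1
      funext i
      exact (hlab _).symm
  · rintro ⟨L, hnd, hall, hpw, hp⟩
    have hlen : L.length = tn.card := by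
      rw [← List.toFinset_card_of_nodup hnd,
        show L.toFinset = Finset.univ by ext t; simp [hall t]]
      simp
    let σ : Fin tn.card ≃ tn.Task := (finCongr hlen.symm).trans (hnd.getEquivOfForallMemList L hall)
    have hσ : ∀ i : Fin tn.card, σ i = L.get (Fin.cast hlen.symm i) := fun i => rfl
    refine ⟨σ, fun i j h => ?_, ?_⟩
    · by_contra hij
      rcases (not_lt.1 hij).lt_or_eq with hlt | rfl
      · rw [hσ, hσ] at h
        exact List.pairwise_iff_get.1 hpw _ _ (by simpa using hlt) h
      · exact tn.irrefl _ h
    · rw [word, ← hp, List.map_map]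
      refine List.ext_getElem (by simp [hlen]) fun k h1 h2 => ?_
      simp [hσ, hlab]

open Classical in
/-- Along an arrangement of an up-closed set of tasks, the letters of its isolated tasks are skipped
and the others used; so its non-isolated part is reached. -/
theorem mem_frontier_of_arrangement (L : List tn.Task) (hnd : L.Nodup)
    (hpw : L.Pairwise fun t u => ¬ tn.prec u t) (hcl : ∀ t ∈ L, ∀ u, tn.prec t u → u ∈ L) :
    (L.toFinset.filter fun t => ¬ tn.IsIsolated t) ∈ tn.frontier lab (L.map lab) := by
  induction L with
  | nil => simp [mem_frontier_nil]
  | cons t L ih =>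
    obtain ⟨htL, hnd⟩ := List.nodup_cons.1 hnd
    obtain ⟨htp, hpw⟩ := List.pairwise_cons.1 hpw
    have ih := ih hnd hpw fun x hx u hu =>
      (List.mem_cons.1 (hcl x (List.mem_cons_of_mem _ hx) u hu)).resolve_left
        fun e => htp x hx (e ▸ hu)
    rw [List.map_cons, mem_frontier_cons, List.toFinset_cons, Finset.filter_insert]
    by_cases h : tn.IsIsolated t
    · rw [if_neg (not_not.2 h)]
      exact Or.inl ih
    · rw [if_pos h]
      refine Or.inr ⟨_, ih, t, ⟨?_, rfl, h, fun u hu => ?_⟩, rfl⟩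
      · simp [htL]
      · refine Finset.mem_filter.2 ⟨List.mem_toFinset.2 ?_, fun hu' => (hu' t).2 hu⟩
        exact (List.mem_cons.1 (hcl t List.mem_cons_self u hu)).resolve_left
          fun e => tn.irrefl t (by rwa [e] at hu)

theorem map_le_of_mem_frontier {p : List A} {X : Finset tn.Task} (hX : X ∈ tn.frontier lab p) :
    X.val.map lab ≤ (p : Multiset A) := by
  induction p generalizing X with
  | nil =>
    rw [mem_frontier_nil] at hX
    simp [hX]
  | cons a p ih =>
    rw [← Multiset.cons_coe]
    rcases (tn.mem_frontier_cons lab).1 hX with h | ⟨Y, hY, t, ht, rfl⟩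
    · exact (ih h).trans (Multiset.le_cons_self _ _)
    · rw [Finset.insert_val_of_notMem ht.1, Multiset.map_cons, ht.2.1]
      exact Multiset.cons_le_cons _ (ih hY)

open Classical in
/-- The positions of the plan that are skipped are filled with isolated tasks, in any order: their
names are those that the multiset condition leaves over. -/
theorem exists_arrangement {p : List A} {X : Finset tn.Task} (hX : X ∈ tn.frontier lab p)
    (J : Finset tn.Task) (hJ : ∀ t ∈ J, tn.IsIsolated t)
    (hp : (p : Multiset A) = X.val.map lab + J.val.map lab) :
    ∃ L : List tn.Task, L.Nodup ∧ (∀ t, t ∈ L ↔ t ∈ X ∨ t ∈ J) ∧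
      L.Pairwise (fun t u => ¬ tn.prec u t) ∧ L.map lab = p := by
  induction p generalizing X J with
  | nil =>
    have h : X.val.map lab + J.val.map lab = 0 := by rw [← hp]; rfl
    rw [add_eq_zero, Multiset.map_eq_zero, Multiset.map_eq_zero, Finset.val_eq_zero,
      Finset.val_eq_zero] at h
    exact ⟨[], by simp [h.1, h.2]⟩
  | cons a p ih =>
    rw [← Multiset.cons_coe] at hp
    rcases (tn.mem_frontier_cons lab).1 hX with h | ⟨Y, hY, t, ht, rfl⟩
    · -- A skipped letter occurs among the names in `J`, as those in `X` are used up by `p`.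
      have hle := tn.map_le_of_mem_frontier lab h
      obtain ⟨t, htJ, rfl⟩ : ∃ t ∈ J, lab t = a := by
        have h1 : (J.val.map lab).count a ≠ 0 := by
          have h2 := congrArg (Multiset.count a) hp
          have h3 := Multiset.count_le_of_le a hle
          rw [Multiset.count_cons_self, Multiset.count_add] at h2
          omega
        simpa using Multiset.count_ne_zero.1 h1
      obtain ⟨L, hnd, hmem, hpw, rfl⟩ := ih h (J.erase t)
        (fun u hu => hJ u (Finset.mem_of_mem_erase hu)) (by
          rw [← Multiset.cons_inj_right (lab t), hp, ← Multiset.add_cons, ← Multiset.map_cons,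
            Finset.erase_val, Multiset.cons_erase htJ])
      have htL : t ∉ L := by
        rw [hmem]
        rintro (h' | h')
        · exact (tn.closed_of_mem_frontier lab h t h').1 (hJ t htJ)
        · exact Finset.notMem_erase t J h'
      refine ⟨t :: L, List.nodup_cons.2 ⟨htL, hnd⟩, fun u => ?_,
        List.pairwise_cons.2 ⟨fun u _ => (hJ t htJ u).2, hpw⟩, rfl⟩
      rw [List.mem_cons, hmem, Finset.mem_erase]
      by_cases hu : u = t
      · simp [hu, htJ]
      · simp [hu]
    · obtain ⟨htY, rfl, hiso, hsucc⟩ := ht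
      obtain ⟨L, hnd, hmem, hpw, rfl⟩ := ih hY J hJ (by
        rw [← Multiset.cons_inj_right (lab t), hp, Finset.insert_val_of_notMem htY,
          Multiset.map_cons, Multiset.cons_add])
      have htL : t ∉ L := by
        rw [hmem]
        rintro (h' | h')
        · exact htY h'
        · exact hiso (hJ t h')
      refine ⟨t :: L, List.nodup_cons.2 ⟨htL, hnd⟩, fun u => ?_,
        List.pairwise_cons.2 ⟨fun u hu hut => ?_, hpw⟩, rfl⟩
      · rw [List.mem_cons, hmem, Finset.mem_insert, or_assoc]
      · rcases (hmem u).1 hu with h' | h'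
        · exact htY ((tn.closed_of_mem_frontier lab hY u h').2 t hut)
        · exact (hJ u h' t).1 hut

/-- The names of the tasks are, with multiplicities, the letters of the plan. -/
theorem coe_eq_map_iff [DecidableEq A] {p : List A} :
    (p : Multiset A) = (Finset.univ : Finset tn.Task).val.map lab ↔
      p.length = tn.card ∧ ∀ t, (List.finRange tn.card).countP (fun u => lab u = lab t) ≤
        p.countP (fun a => a = lab t) := by
  have hval : (Finset.univ : Finset tn.Task).val.map lab =
      (((List.finRange tn.card).map lab : List A) : Multiset A) := rfl
  have hcount : ∀ t, (List.finRange tn.card).countP (fun u => lab u = lab t) =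
      ((List.finRange tn.card).map lab).count (lab t) := fun t => by
    rw [List.count, List.countP_map]
    congr 1
  have hcount' : ∀ t, p.countP (fun a => a = lab t) = p.count (lab t) := fun t => by
    rw [List.count]
    congr 1
  simp only [hval, Multiset.coe_eq_coe, hcount, hcount']
  constructor
  · intro h
    exact ⟨by simpa using h.length_eq, fun t => (h.count_eq _).ge⟩
  · rintro ⟨hlen, h⟩
    refine (List.Subperm.perm_of_length_le (List.subperm_ext_iff.2 fun x hx => ?_)
      (by simp [hlen])).symm
    obtain ⟨t, _, rfl⟩ := List.mem_map.1 hx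
    exact h t

/-- The criterion that the algorithm tests. -/
theorem exists_arrangement_iff {p : List A} :
    (∃ L : List tn.Task, L.Nodup ∧ (∀ t, t ∈ L) ∧ L.Pairwise (fun t u => ¬ tn.prec u t) ∧
        L.map lab = p) ↔
      (p : Multiset A) = (Finset.univ : Finset tn.Task).val.map lab ∧
        ∃ X ∈ tn.frontier lab p, ∀ t, ¬ tn.IsIsolated t → t ∈ X := by
  classical
  constructor
  · rintro ⟨L, hnd, hall, hpw, rfl⟩
    refine ⟨?_, _, tn.mem_frontier_of_arrangement lab L hnd hpw fun _ _ u _ => hall u, ?_⟩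
    · rw [← show L.toFinset = Finset.univ by ext t; simp [hall t], List.toFinset_val,
        hnd.dedup]
      rfl
    · intro t ht
      simp [hall t, ht]
  · rintro ⟨hp, X, hX, hall⟩
    have hXJ : (Finset.univ : Finset tn.Task).val = X.val + Xᶜ.val := by
      rw [← Finset.disjUnion_val X Xᶜ disjoint_compl_right, Finset.disjUnion_eq_union,
        Finset.union_compl]
    obtain ⟨L, hnd, hmem, h⟩ := tn.exists_arrangement lab hX Xᶜ
      (fun t ht => by_contra fun h => Finset.mem_compl.1 ht (hall t h))
      (by rw [hp, hXJ, Multiset.map_add])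
    exact ⟨L, hnd, fun t => (hmem t).2 (by rw [Finset.mem_compl]; exact em _), h⟩

end TaskNetwork

/-! ### Plan verification for primitive networks -/

/-- A primitive network cannot be decomposed further, so it has to be linearized itself. -/
theorem planVerification_iff {I : Instance} (h : I.tn.IsPrimitive) :
    PlanVerification I ↔ I.D.LinearizesTo I.tn I.plan ∧ I.D.Executable I.s₀ I.plan := by
  constructor
  · rintro ⟨sol, ⟨_, _, tn', hdec, _, e, hlab, hprec⟩, ⟨σ, hσ, hword⟩, hex⟩
    refine ⟨?_, hex⟩
    obtain rfl : tn' = I.tn := by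
      rcases Relation.ReflTransGen.cases_head hdec with h' | ⟨_, ⟨t, c, _, ht, _⟩, _⟩
      · exact h'.symm
      · obtain ⟨a, ha⟩ := h t
        rw [ha] at ht
        cases ht
    have hcard : I.tn.card = sol.card := by simpa using Fintype.card_congr e
    refine ⟨((finCongr hcard).trans σ).trans e.symm, fun i j hij => ?_, ?_⟩
    · have := hσ _ _ (by simpa using hprec _ _ hij)
      simpa using this
    · rw [← hword]
      refine List.ext_getElem (by simp [TaskNetwork.word, hcard]) fun k h1 h2 => ?_
      simp [TaskNetwork.word, ← hlab]
  · rintro ⟨hlin, hex⟩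
    exact ⟨I.tn, ⟨h, ⟨_, hlin, hex⟩, I.tn, .refl, h, Equiv.refl _, fun _ => rfl, fun _ _ => id⟩,
      hlin, hex⟩

/-! ### The algorithm runs in polynomial time -/

section Network

variable {ι : Type} {e : ι → Data}

open Classical in
/-- The 0-1 matrix of the order of a network, as in the encoding of networks. -/
noncomputable def encPrec {A C : Type} (tn : TaskNetwork A C) : Data :=
  encFn fun t => encFn fun u => Data.ofBool (decide (tn.prec t u))

/-- The table of the numbers of the actions that name the tasks. -/
def encLab {n a : ℕ} (lab : Fin n → Fin a) : Data := encFn fun t => Data.ofNat (lab t)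

variable {a c : ι → ℕ} {tn : ∀ i, TaskNetwork (Fin (a i)) (Fin (c i))}
  {lab : ∀ i, (tn i).Task → Fin (a i)}

theorem PolyDec.prec {t u : ∀ i, (tn i).Task} (hprec : PolyTime e fun i => encPrec (tn i))
    (ht : PolyTime e fun i => Data.ofNat (t i)) (hu : PolyTime e fun i => Data.ofNat (u i)) :
    PolyDec e fun i => (tn i).prec (t i) (u i) := by
  classical
  exact PolyDec.iff_polyTime.2 ((hprec.get ht).get hu)

theorem PolyTime.card_of_encPrec (hprec : PolyTime e fun i => encPrec (tn i)) :
    PolyTime e fun i => Data.ofNat (tn i).card :=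
  hprec.card_of_encFn

theorem PolyDec.isIsolated {t : ∀ i, (tn i).Task} (hprec : PolyTime e fun i => encPrec (tn i))
    (ht : PolyTime e fun i => Data.ofNat (t i)) : PolyDec e fun i => (tn i).IsIsolated (t i) := by
  refine PolyDec.forall_fin (P := fun i u => ¬ (tn i).prec (t i) u ∧ ¬ (tn i).prec u (t i))
    hprec.card_of_encPrec ?_
  exact (PolyDec.prec (tn := fun j : Σ i, (tn i).Task => tn j.1) hprec.lift ht.lift
    PolyTime.refl.right).not.and (PolyDec.prec (tn := fun j : Σ i, (tn i).Task => tn j.1)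
      hprec.lift PolyTime.refl.right ht.lift).not

theorem PolyDec.canPrepend {x : ∀ i, Fin (a i)} {X : ∀ i, Finset (tn i).Task}
    {t : ∀ i, (tn i).Task} (hprec : PolyTime e fun i => encPrec (tn i))
    (hlab : PolyTime e fun i => encLab (lab i)) (hx : PolyTime e fun i => Data.ofNat (x i))
    (hX : PolyTime e fun i => encSet (X i)) (ht : PolyTime e fun i => Data.ofNat (t i)) :
    PolyDec e fun i => (tn i).CanPrepend (lab i) (x i) (X i) (t i) := by
  refine (PolyDec.mem_encSet hX ht).not.and ((PolyDec.fin_eq (hlab.get ht) hx).and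
    ((PolyDec.isIsolated hprec ht).not.and
      (PolyDec.forall_fin (P := fun i u => (tn i).prec (t i) u → u ∈ X i)
        hprec.card_of_encPrec ?_)))
  exact (PolyDec.prec (tn := fun j : Σ i, (tn i).Task => tn j.1) hprec.lift ht.lift
    PolyTime.refl.right).imp
      (PolyDec.mem_encSet (s := fun j : Σ i, (tn i).Task => X j.1) hX.lift PolyTime.refl.right)

theorem PolyTime.finsetInsert {n : ι → ℕ} {X : ∀ i, Finset (Fin (n i))} {t : ∀ i, Fin (n i)}
    (hX : PolyTime e fun i => encSet (X i)) (ht : PolyTime e fun i => Data.ofNat (t i)) :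
    PolyTime e fun i => encSet (insert (t i) (X i)) := by
  refine PolyTime.tabulateSet hX.card_of_encFn ?_
  have h1 := PolyDec.fin_eq (n := fun j : Σ i, Fin (n i) => n j.1) (a := fun j => j.2)
    (b := fun j => t j.1) (e := fun j => Data.node (e j.1) (Data.ofNat j.2))
    PolyTime.refl.right ht.lift
  have h2 := PolyDec.mem_encSet (n := fun j : Σ i, Fin (n i) => n j.1) (k := fun j => j.2)
    (s := fun j => X j.1) (e := fun j => Data.node (e j.1) (Data.ofNat j.2))
    hX.lift PolyTime.refl.right
  exact (h1.or h2).congr fun j => Finset.mem_insert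

/-- A list of sets of tasks. -/
def encSets {n : ℕ} (F : List (Finset (Fin n))) : Data := Data.ofList (F.map encSet)

theorem size_encSets_le {n : ℕ} (F : List (Finset (Fin n))) :
    (encSets F).size ≤ F.length * (4 * n + 2) + 1 := by
  induction F with
  | nil => simp [encSets, Data.ofList, Data.size]
  | cons X F ih =>
    have := size_encSet_le X
    simp only [encSets, List.map_cons, Data.ofList, Data.size, List.length_cons, add_mul] at ih ⊢
    omega

theorem size_encSets_insertNew_le {n : ℕ} (F : List (Finset (Fin n))) (X : Finset (Fin n)) :
    (encSets (insertNew F X)).size ≤ (encSets F).size + (4 * n + 2) := by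
  have := size_encSet_le X
  unfold insertNew
  split_ifs
  · omega
  · simp only [encSets, List.map_cons, Data.ofList, Data.size]
    omega

theorem PolyTime.insertNew_encSets {n : ι → ℕ} {F : ∀ i, List (Finset (Fin (n i)))}
    {X : ∀ i, Finset (Fin (n i))} (hF : PolyTime e fun i => encSets (F i))
    (hX : PolyTime e fun i => encSet (X i)) :
    PolyTime e fun i => encSets (insertNew (F i) (X i)) := by
  have h : PolyDec e fun i => X i ∈ F i :=
    (PolyDec.exists_mem (P := fun i Y => X i = Y) hF
      (PolyDec.encSet_eq (e := fun j : Σ i, Finset (Fin (n i)) => Data.node (e j.1) (encSet j.2))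
        (n := fun j => n j.1) (s := fun j => X j.1) (t := fun j => j.2)
        hX.lift PolyTime.refl.right)).congr fun i => by simp
  convert h.ite hF (hX.node hF) using 2 with i
  unfold insertNew
  split_ifs <;> rfl

theorem PolyBdd.four_mul_add {n : ι → ℕ} (hn : PolyTime e fun i => Data.ofNat (n i)) :
    PolyBdd e fun i => 4 * n i + 2 :=
  (hn.size_bdd.mul (PolyBdd.const 2)).mono fun i => by rw [Data.size_ofNat]; omega

theorem size_extend_le {a c : ℕ} (tn : TaskNetwork (Fin a) (Fin c)) (lab : tn.Task → Fin a)
    (x : Fin a) (G : List (Finset tn.Task)) (X : Finset tn.Task) :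
    (encSets (tn.extend lab x G X)).size ≤
      (encSets G).size + tn.card * (4 * tn.card + 2) := by
  refine (PolyTime.foldl_le_add (m := 4 * tn.card + 2) (fun G => (encSets G).size) _
    (fun G t _ => ?_) G).trans_eq (by rw [List.length_finRange])
  split_ifs
  · exact size_encSets_insertNew_le _ _
  · omega

theorem PolyTime.extend {x : ∀ i, Fin (a i)} {G : ∀ i, List (Finset (tn i).Task)}
    {X : ∀ i, Finset (tn i).Task} (hprec : PolyTime e fun i => encPrec (tn i))
    (hlab : PolyTime e fun i => encLab (lab i)) (hx : PolyTime e fun i => Data.ofNat (x i))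
    (hG : PolyTime e fun i => encSets (G i)) (hX : PolyTime e fun i => encSet (X i)) :
    PolyTime e fun i => encSets ((tn i).extend (lab i) (x i) (G i) (X i)) := by
  classical
  have hn := hprec.card_of_encPrec
  refine foldl_of_add (α := fun i => (tn i).Task) (β := fun i => List (Finset (tn i).Task))
    (eb := fun i => encSets) (ea := fun i k => Data.ofNat k) hn.finRange hG ?_
    (PolyBdd.four_mul_add hn) (fun i G t _ => ?_)
  · let E := fun j : Σ i, (tn i).Task × List (Finset (tn i).Task) =>
      Data.node (e j.1) (Data.node (Data.ofNat j.2.1) (encSets j.2.2))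
    have hX' : PolyTime E fun j => encSet (X j.1) := hX.lift
    have ht : PolyTime E fun j => Data.ofNat j.2.1 := refl.right.left
    have hG' : PolyTime E fun j => encSets j.2.2 := refl.right.right
    have h : PolyDec E fun j => (tn j.1).CanPrepend (lab j.1) (x j.1) (X j.1) j.2.1 :=
      PolyDec.canPrepend (tn := fun j : Σ i, (tn i).Task × List (Finset (tn i).Task) => tn j.1)
        hprec.lift hlab.lift hx.lift hX' ht
    have h' : PolyTime E fun j => encSets (insertNew j.2.2 (insert j.2.1 (X j.1))) :=
      hG'.insertNew_encSets (hX'.finsetInsert ht)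
    convert h.ite h' hG' using 2 with j
    split_ifs
    · congr
    · rfl
  · split_ifs
    · exact size_encSets_insertNew_le _ _
    · omega

theorem PolyTime.frontierStep {x : ∀ i, Fin (a i)} {F : ∀ i, List (Finset (tn i).Task)}
    (hprec : PolyTime e fun i => encPrec (tn i)) (hlab : PolyTime e fun i => encLab (lab i))
    (hF : PolyTime e fun i => encSets (F i)) (hx : PolyTime e fun i => Data.ofNat (x i)) :
    PolyTime e fun i => encSets ((tn i).frontierStep (lab i) (F i) (x i)) := by
  have hn := hprec.card_of_encPrec
  refine foldl_of_add (α := fun i => Finset (tn i).Task)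
    (β := fun i => List (Finset (tn i).Task)) (eb := fun i => encSets) (ea := fun i => encSet)
    hF hF ?_ ((hn.size_bdd.mul (PolyBdd.four_mul_add hn)).mono fun i => ?_)
    (fun i G X _ => size_extend_le (tn i) (lab i) (x i) G X)
  · exact PolyTime.extend (tn := fun j : Σ i, Finset (tn i).Task × List (Finset (tn i).Task) =>
      tn j.1) (lab := fun j => lab j.1) (x := fun j => x j.1) (X := fun j => j.2.1)
      (G := fun j => j.2.2) hprec.lift hlab.lift hx.lift refl.right.right refl.right.left
  · exact Nat.mul_le_mul_right _ (by rw [Data.size_ofNat]; omega)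

/-- The frontier is computable in polynomial time on networks of bounded width. -/
theorem PolyTime.frontier {w : ℕ} {p : ∀ i, List (Fin (a i))} (hw : ∀ i, (tn i).gpow ≤ w)
    (hprec : PolyTime e fun i => encPrec (tn i)) (hlab : PolyTime e fun i => encLab (lab i))
    (hp : PolyTime e fun i => Data.ofList ((p i).map fun x : Fin (a i) => Data.ofNat x)) :
    PolyTime e fun i => encSets ((tn i).frontier (lab i) (p i)) := by
  have hn := hprec.card_of_encPrec
  refine foldl (α := fun i => Fin (a i)) (β := fun i => List (Finset (tn i).Task))
    (eb := fun i => encSets) (ea := fun i x => Data.ofNat x)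
    (m := fun i => ((tn i).card + 1) ^ w * (4 * (tn i).card + 2) + 1) hp.reverse ?_ ?_ ?_ ?_
  · exact (tabulateSet (s := fun i => (∅ : Finset (tn i).Task)) hn
      ((PolyDec.const False).congr fun j => by simp)).node nil
  · exact PolyTime.frontierStep (tn := fun j : Σ i, Fin (a i) × List (Finset (tn i).Task) => tn j.1)
      (lab := fun j => lab j.1) (x := fun j => j.2.1) (F := fun j => j.2.2)
      hprec.lift hlab.lift refl.right.right refl.right.left
  · refine PolyBdd.add (((hn.size_bdd.mono fun i => ?_).pow w).mul (PolyBdd.four_mul_add hn))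
      (PolyBdd.const 1)
    rw [Data.size_ofNat]; omega
  · intro i l' _
    have h := (tn i).length_frontier_le (lab i) (hw i) l'.reverse
    rw [TaskNetwork.frontier, List.reverse_reverse] at h
    exact (size_encSets_le _).trans (Nat.add_le_add_right (Nat.mul_le_mul_right _ h) 1)

theorem PolyDec.exists_arrangement {w : ℕ} {p : ∀ i, List (Fin (a i))} (hw : ∀ i, (tn i).gpow ≤ w)
    (hprec : PolyTime e fun i => encPrec (tn i)) (hlab : PolyTime e fun i => encLab (lab i))
    (hp : PolyTime e fun i => Data.ofList ((p i).map fun x : Fin (a i) => Data.ofNat x)) :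
    PolyDec e fun i => ∃ L : List (tn i).Task, L.Nodup ∧ (∀ t, t ∈ L) ∧
      L.Pairwise (fun t u => ¬ (tn i).prec u t) ∧ L.map (lab i) = p i := by
  have hn := hprec.card_of_encPrec
  have hcount : PolyDec e fun i => ∀ t, (List.finRange (tn i).card).countP
      (fun u => lab i u = lab i t) ≤ (p i).countP (fun x => x = lab i t) := by
    refine PolyDec.forall_fin hn ?_
    have hl : PolyTime (fun j : Σ i, (tn i).Task => Data.node (e j.1) (Data.ofNat j.2))
        fun j => Data.ofNat (lab j.1 j.2) :=
      PolyTime.get (v := fun j : Σ i, (tn i).Task => fun t => Data.ofNat (lab j.1 t))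
        hlab.lift PolyTime.refl.right
    refine PolyDec.nat_le (PolyTime.countP
      (l := fun j : Σ i, (tn i).Task => List.finRange (tn j.1).card)
      (ea := fun j k => Data.ofNat k) (PolyTime.finRange hn.lift) ?_)
      (PolyTime.countP (l := fun j : Σ i, (tn i).Task => p j.1)
        (ea := fun j k => Data.ofNat k) hp.lift ?_)
    · let E := fun j : Σ j : (Σ i, (tn i).Task), (tn j.1).Task =>
        Data.node (Data.node (e j.1.1) (Data.ofNat j.1.2)) (Data.ofNat j.2)
      have h1 : PolyTime E fun j => Data.ofNat (lab j.1.1 j.1.2) := hl.lift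
      have h2 : PolyTime E fun j => encLab (lab j.1.1) :=
        PolyTime.refl.left.left.trans (hlab.reindex fun j : Σ j : (Σ i, (tn i).Task),
          (tn j.1).Task => j.1.1)
      have h3 : PolyTime E fun j => Data.ofNat j.2 := PolyTime.refl.right
      exact (PolyDec.fin_eq (n := fun j : Σ j : (Σ i, (tn i).Task), (tn j.1).Task => a j.1.1)
        (h2.get h3) h1).congr fun j => by simp
    · let E := fun j : Σ j : (Σ i, (tn i).Task), Fin (a j.1) =>
        Data.node (Data.node (e j.1.1) (Data.ofNat j.1.2)) (Data.ofNat j.2)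
      have h1 : PolyTime E fun j => Data.ofNat (lab j.1.1 j.1.2) := hl.lift
      have h3 : PolyTime E fun j => Data.ofNat j.2 := PolyTime.refl.right
      exact (PolyDec.fin_eq h3 h1).congr fun j => by simp
  have hmem : PolyDec e fun i => ∃ X ∈ (tn i).frontier (lab i) (p i),
      ∀ t, ¬ (tn i).IsIsolated t → t ∈ X := by
    refine PolyDec.exists_mem (PolyTime.frontier hw hprec hlab hp) ?_
    refine PolyDec.forall_fin (n := fun j : Σ i, Finset (tn i).Task => (tn j.1).card)
      (P := fun j t => ¬ (tn j.1).IsIsolated t → t ∈ j.2) hn.lift ?_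
    let E := fun j : Σ j : (Σ i, Finset (tn i).Task), (tn j.1).Task =>
      Data.node (Data.node (e j.1.1) (encSet j.1.2)) (Data.ofNat j.2)
    have h1 : PolyTime E fun j => encPrec (tn j.1.1) :=
      PolyTime.refl.left.left.trans (hprec.reindex
        fun j : Σ j : (Σ i, Finset (tn i).Task), (tn j.1).Task => j.1.1)
    have h2 : PolyTime E fun j => encSet j.1.2 := PolyTime.refl.left.right
    have h3 : PolyTime E fun j => Data.ofNat j.2 := PolyTime.refl.right
    exact (PolyDec.isIsolated h1 h3).not.imp (PolyDec.mem_encSet h2 h3)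
  exact (((PolyDec.nat_eq hp.length hn).and hcount).and hmem).congr fun i => by
    rw [TaskNetwork.exists_arrangement_iff, TaskNetwork.coe_eq_map_iff]

end Network

/-! ### Execution of a plan -/

/-- Carry out an action; the truth value records whether all actions so far were executable. -/
def Domain.execStep (D : Domain) (r : Bool × D.State) (a : D.Action) : Bool × D.State :=
  (r.1 && decide (D.pre a ⊆ r.2), (r.2 \ D.del a) ∪ D.add a)

theorem Domain.executable_iff (D : Domain) (s : D.State) (p : List D.Action) :
    D.Executable s p ↔ (p.foldl D.execStep (true, s)).1 = true := by
  have h : ∀ (p : List D.Action) (b : Bool) (s : D.State),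
      (p.foldl D.execStep (b, s)).1 = true ↔ b = true ∧ D.Executable s p := by
    intro p
    induction p with
    | nil => simp [Domain.Executable]
    | cons a p ih =>
      intro b s
      rw [List.foldl_cons, Domain.execStep, ih, Domain.Executable]
      simp [and_assoc]
  simp [h]

/-- The table of the effects of the actions, as in the encoding of domains. -/
def encEffects (D : Domain) : Data :=
  encFn fun a => Data.node (encSet (D.pre a)) (Data.node (encSet (D.del a)) (encSet (D.add a)))

section Domain

variable {ι : Type} {e : ι → Data} {D : ι → Domain}

theorem PolyTime.union_sdiff {n : ι → ℕ} {r s t : ∀ i, Finset (Fin (n i))}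
    (hr : PolyTime e fun i => encSet (r i)) (hs : PolyTime e fun i => encSet (s i))
    (ht : PolyTime e fun i => encSet (t i)) :
    PolyTime e fun i => encSet ((r i \ s i) ∪ t i) := by
  refine PolyTime.tabulateSet hr.card_of_encFn ?_
  let E := fun j : Σ i, Fin (n i) => Data.node (e j.1) (Data.ofNat j.2)
  have hk : PolyTime E fun j => Data.ofNat j.2 := refl.right
  have hr' : PolyTime E fun j => encSet (r j.1) := hr.lift
  have hs' : PolyTime E fun j => encSet (s j.1) := hs.lift
  have ht' : PolyTime E fun j => encSet (t j.1) := ht.lift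
  exact (((PolyDec.mem_encSet hr' hk).and (PolyDec.mem_encSet hs' hk).not).or
    (PolyDec.mem_encSet ht' hk)).congr fun j => by simp

theorem PolyDec.executable {s : ∀ i, (D i).State} {p : ∀ i, List (D i).Action}
    (hD : PolyTime e fun i => encEffects (D i)) (hs : PolyTime e fun i => encSet (s i))
    (hp : PolyTime e fun i => Data.ofList ((p i).map fun x : (D i).Action => Data.ofNat x)) :
    PolyDec e fun i => (D i).Executable (s i) (p i) := by
  have := PolyTime.foldl_of_add (f := fun i => (D i).execStep)
    (eb := fun i r => Data.node (Data.ofBool r.1) (encSet r.2))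
    (init := fun i => (true, s i)) (m := fun i => 4 * (D i).numProps + 2 + 2) hp
    ((PolyTime.const (Data.ofBool true)).node hs) ?_
    ((PolyBdd.four_mul_add hs.card_of_encFn).add (PolyBdd.const 2)) ?_
  · refine (PolyDec.iff_polyTime.2 ?_ : PolyDec e fun i =>
      ((p i).foldl (D i).execStep (true, s i)).1 = true).congr
        fun i => (D i).executable_iff (s i) (p i)
    convert this.left using 2 with i
    simp [Data.left]
  · let E := fun j : Σ i, (D i).Action × (Bool × (D i).State) => Data.node (e j.1)
      (Data.node (Data.ofNat j.2.1) (Data.node (Data.ofBool j.2.2.1) (encSet j.2.2.2)))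
    have hx : PolyTime E fun j => Data.ofNat j.2.1 := PolyTime.refl.right.left
    have hb : PolyTime E fun j => Data.ofBool j.2.2.1 := PolyTime.refl.right.right.left
    have hs : PolyTime E fun j => encSet j.2.2.2 := PolyTime.refl.right.right.right
    have hD' : PolyTime E fun j => encEffects (D j.1) := hD.lift
    have heff := hD'.get hx
    have hpre : PolyTime E fun j => encSet ((D j.1).pre j.2.1) := heff.left
    have hdel : PolyTime E fun j => encSet ((D j.1).del j.2.1) := heff.right.left
    have hadd : PolyTime E fun j => encSet ((D j.1).add j.2.1) := heff.right.right
    refine PolyTime.node ?_ (hs.union_sdiff hdel hadd)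
    have hb' : PolyDec E fun j => j.2.2.1 = true :=
      PolyDec.iff_polyTime.2 (by simpa using hb)
    simpa only [Domain.execStep, Bool.decide_and, Bool.decide_eq_true] using
      PolyDec.iff_polyTime.1 (hb'.and (PolyDec.encSet_subset hpre hs))
  · intro i r x _
    have h1 := Data.size_ofBool_le ((D i).execStep r x).1
    have h2 := size_encSet_le ((D i).execStep r x).2
    have h3 := (encSet r.2).one_le_size
    have h4 := (Data.ofBool r.1).one_le_size
    simp only [Data.size]
    omega

end Domain

end HTN

theorem mainTheorem3 (w : ℕ) :
    HTN.PolyTimeSolvableOn HTN.encInstance HTN.PlanVerification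
      {I : HTN.Instance | I.tn.IsPrimitive ∧ I.tn.gpow ≤ w} := by
  open HTN in
  let K : Set Instance := {I | I.tn.IsPrimitive ∧ I.tn.gpow ≤ w}
  choose lab hlab using fun I : K => I.2.1
  let e : K → Data := fun I => encInstance I
  have heff : PolyTime e fun I => encEffects I.1.D := PolyTime.refl.left.right.left
  have hprec : PolyTime e fun I => encPrec I.1.tn := PolyTime.refl.right.left.left
  have hs : PolyTime e fun I => encSet I.1.s₀ := PolyTime.refl.right.right.left
  have hp : PolyTime e fun I => Data.ofList (I.1.plan.map fun x : I.1.D.Action => Data.ofNat x) := by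
    have h := (PolyTime.refl (e := e)).right.right.right
    convert h using 2 with I
    -- The encoding first coerces the plan to a list of numbers.
    simp only [e, encInstance, Data.right, List.bind_eq_flatMap, List.pure_def, List.map_flatMap,
      List.map_cons, List.map_nil]
    rw [List.map_eq_flatMap]
  have hnames : PolyTime e fun I => encFn fun t => encName (I.1.tn.label t) :=
    PolyTime.refl.right.left.right
  have hlabs : PolyTime e fun I => encLab (lab I) := by
    refine PolyTime.tabulate hprec.card_of_encPrec ?_
    let E := fun j : Σ I : K, I.1.tn.Task => Data.node (e j.1) (Data.ofNat j.2)
    have ht : PolyTime E fun j => Data.ofNat j.2 := PolyTime.refl.right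
    have hn : PolyTime E fun j => encFn fun t => encName (j.1.1.tn.label t) := hnames.lift
    have h := (hn.get ht).right
    simpa only [hlab, encName, Data.right] using h
  obtain ⟨P, q, hP⟩ : PolyDec e fun I => PlanVerification I.1 :=
    ((PolyDec.exists_arrangement (tn := fun I : K => I.1.tn) (lab := lab) (fun I => I.2.2) hprec
      hlabs hp).and (PolyDec.executable heff hs hp)).congr fun I => by
        rw [planVerification_iff I.2.1, Domain.LinearizesTo,
          TaskNetwork.exists_linearization_iff _ (lab I) (hlab I)]
  exact ⟨P, q, fun I hI => hP ⟨I, hI⟩⟩
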